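/- Notation: $\|\cdot\|$ is the spectral norm, $\|\cdot\|_F$ the Frobenius norm, and $\mathrm{off}(G)=G-\mathrm{diag}(g_{11},\dots,g_{nn})$. For every function $p:\mathbb N\to\mathbb R$ there is a function $\gamma_1:\mathbb N\to(0,\infty)$ (so $\gamma_1=\gamma_1(n)$ depends only on $n$ and on the error constant $p(n)$ of the eigensolver) such that the following holds. Let $A\in\mathbb R^{n\times n}$ be symmetric, let $0<\omega\le\upsilon\le\frac12$ be two unit roundoffs, let $\nu>0$ and $d>0$, and suppose: (1) $Z\in\mathbb R^{n\times n}$ is a matrix of eigenvectors of $A$ computed in precision $\upsilon$ by a LAPACK/EISPACK-type symmetric eigensolver, i.e. there are numbers $d_1,\dots,d_n$ in monotone (increasing or decreasing) order and matrices $E,\delta Z$ such that $A+E=(Z+\delta Z)\,\mathrm{diag}(d_1,\dots,d_n)\,(Z+\delta Z)^T$, $Z+\delta Z$ is orthogonal, $\|\delta Z\|\le p(n)\upsilon$ and $\|E\|\le p(n)\|A\|\upsilon$. (2) $Q\in\mathbb R^{n\times n}$ is obtained by applying modified Gram-Schmidt orthogonalization to the columns of $Z$ in floating-point arithmetic of precision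 $\omega$, without breakdown (standard model: each elementary operation returns its exact result times $1+\delta$ with $|\delta|\le\omega$). Put $T^{(0)}=Q^TAQ$, and let $T^{(k)}$ be the matrix after the first $k$ updates of one sweep of the row-cyclic Jacobi iteration with threshold $\nu$, carried out exactly: the pivots $(i,j)$, $i<j$, are visited in the order $(1,2),\dots,(1,n),(2,3),\dots,(n-1,n)$, and at $(i,j)$ the current matrix $T$ is updated as follows. If $|t_{ij}|\le\nu\min\{|t_{ii}|,|t_{jj}|\}$, then $t_{ij}$ and $t_{ji}$ are set to $0$. Otherwise $T$ is replaced by $J^TTJ$, where $J$ agrees with $I_n$ except that $J_{ii}=J_{jj}=c$, $J_{ij}=s$, $J_{ji}=-s$. Here $(c,s)=(1,0)$ if $t_{ij}=0$, and otherwise $c=(1+t^2)^{-1/2}$, $s=tc$, with $\mu=(t_{jj}-t_{ii})/(2t_{ij})$, $t=1/(\mu+\sqrt{1+\mu^2})$ if $\mu\ge0$ and $t=1/(\mu-\sqrt{1+\mu^2})$ if $\mu<0$. If any two distinct eigenvalues $\lambda\ne\lambda'$ of $T^{(0)}$ satisfy $|\lambda-\lambda'|\ge d$, and if $\gamma_1(n)\,\|A\|\,\upsilon<d/(4\sqrt2)$,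 then, with $N=n(n-1)/2$ (one full sweep), $$\|\mathrm{off}(T^{(N)})\|_F\le\frac{\sqrt{34/9}}{d}\,\|\mathrm{off}(T^{(0)})\|_F^2 .$$ -/

import Mathlib

noncomputable section

namespace MixedJacobi

open Matrix

/-! ### Norms and the off-diagonal part -/

/-- The spectral norm `‖M‖` (the operator norm induced by the Euclidean vector norm). -/
def specNorm {n : ℕ} (M : Matrix (Fin n) (Fin n) ℝ) : ℝ :=
  ‖Matrix.toEuclideanCLM (n := Fin n) (𝕜 := ℝ) M‖

/-- The Frobenius norm `‖M‖_F`. -/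
def frobNorm {n : ℕ} (M : Matrix (Fin n) (Fin n) ℝ) : ℝ :=
  Real.sqrt (∑ i, ∑ j, M i j ^ 2)

/-- `off(G) = G - diag(g₁₁, …, gₙₙ)`. -/
def off {n : ℕ} (G : Matrix (Fin n) (Fin n) ℝ) : Matrix (Fin n) (Fin n) ℝ :=
  G - Matrix.diagonal G.diag

/-! ### The low-precision eigensolver -/

/-- `Z` is a matrix of eigenvectors of the symmetric matrix `A` as delivered, in precision `υ`, by
a LAPACK / EISPACK symmetric eigensolver with error constant `p`: for some approximate eigenvalues
`d₁, …, dₙ`, listed in order of size, `Z` is within `p υ` of an orthogonal matrix `Z + δZ` that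
gives an exact spectral decomposition `(Z + δZ) diag(d) (Z + δZ)ᵀ` of a matrix `A + E` with
`‖E‖ ≤ p ‖A‖ υ`. -/
def IsComputedEigenvectors {n : ℕ} (p υ : ℝ) (A Z : Matrix (Fin n) (Fin n) ℝ) : Prop :=
  ∃ (d : Fin n → ℝ) (E δZ : Matrix (Fin n) (Fin n) ℝ),
    (Monotone d ∨ Antitone d) ∧
    Z + δZ ∈ Matrix.orthogonalGroup (Fin n) ℝ ∧
    specNorm δZ ≤ p * υ ∧
    specNorm E ≤ p * specNorm A * υ ∧
    A + E = (Z + δZ) * Matrix.diagonal d * (Z + δZ)ᵀ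

/-! ### Modified Gram-Schmidt in floating-point arithmetic of unit roundoff `u` -/

/-- The standard model of floating-point arithmetic: `c` is an admissible computed value of an
operation with exact result `x`, i.e. `c = x (1 + δ)` for some `|δ| ≤ u`. -/
def Rnd (u x c : ℝ) : Prop := ∃ δ : ℝ, |δ| ≤ u ∧ c = x * (1 + δ)

/-- `FlSum u s c`: `c` is an admissible computed value of the sum of the (nonempty) multiset `s`,
where the `card s - 1` rounded additions may be performed in any order. -/
inductive FlSum (u : ℝ) : Multiset ℝ → ℝ → Prop
  | single (x : ℝ) : FlSum u {x} x
  | add {s t : Multiset ℝ} {a b c : ℝ} (hs : FlSum u s a) (ht : FlSum u t b)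
      (hc : Rnd u (a + b) c) : FlSum u (s + t) c

/-- `r` is an admissible computed value of the inner product `xᵀ y`. -/
def FlDot {n : ℕ} (u : ℝ) (x y : Fin n → ℝ) (r : ℝ) : Prop :=
  ∃ m : Fin n → ℝ, (∀ i, Rnd u (x i * y i) (m i)) ∧ FlSum u (Finset.univ.val.map m) r

/-- `Q` is an admissible output of the modified Gram-Schmidt process, run without breakdown on the
columns of `Z` in precision `u`. `V k` is the working array at the start of stage `k`; stage `k`
computes `r_kk = ‖v_k‖`, `q_k = v_k / r_kk` and, for `j > k`, `r_kj = q_kᵀ v_j` and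
`v_j ← v_j - r_kj q_k`, every arithmetic operation being rounded. -/
def IsComputedMGS {n : ℕ} (u : ℝ) (Z Q : Matrix (Fin n) (Fin n) ℝ) : Prop :=
  ∃ (V : ℕ → Matrix (Fin n) (Fin n) ℝ) (R : Matrix (Fin n) (Fin n) ℝ),
    V 0 = Z ∧
    (∀ k : Fin n, ∃ σ : ℝ,
      FlDot u (fun i => V k i k) (fun i => V k i k) σ ∧ Rnd u (Real.sqrt σ) (R k k)) ∧
    (∀ k : Fin n, R k k ≠ 0) ∧
    (∀ k i : Fin n, Rnd u (V k i k / R k k) (Q i k)) ∧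
    (∀ k j : Fin n, k < j → FlDot u (fun i => Q i k) (fun i => V k i j) (R k j)) ∧
    (∀ k j : Fin n, k < j → ∀ i : Fin n, ∃ m : ℝ,
      Rnd u (R k j * Q i k) m ∧ Rnd u (V k i j - m) (V (k + 1) i j))

/-! ### The cyclic Jacobi iteration with threshold -/

/-- The tangent `t` of the rotation angle for the pivot `(i, j)` (used when `tᵢⱼ ≠ 0`). -/
def jacobiTan {n : ℕ} (T : Matrix (Fin n) (Fin n) ℝ) (i j : Fin n) : ℝ :=
  let μ := (T j j - T i i) / (2 * T i j)
  if 0 ≤ μ then 1 / (μ + Real.sqrt (1 + μ ^ 2)) else 1 / (μ - Real.sqrt (1 + μ ^ 2))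

/-- The cosine `c` of the rotation angle. -/
def jacobiCos {n : ℕ} (T : Matrix (Fin n) (Fin n) ℝ) (i j : Fin n) : ℝ :=
  if T i j = 0 then 1 else 1 / Real.sqrt (1 + jacobiTan T i j ^ 2)

/-- The sine `s = t c` of the rotation angle. -/
def jacobiSin {n : ℕ} (T : Matrix (Fin n) (Fin n) ℝ) (i j : Fin n) : ℝ :=
  if T i j = 0 then 0 else jacobiTan T i j * jacobiCos T i j

/-- The rotation `J = I + [eᵢ, eⱼ] [[c - 1, s], [-s, c - 1]] [eᵢ, eⱼ]ᵀ` (for `i ≠ j`). -/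
def jacobiRotation {n : ℕ} (i j : Fin n) (c s : ℝ) : Matrix (Fin n) (Fin n) ℝ :=
  1 + Matrix.single i i (c - 1) + Matrix.single i j s
    + Matrix.single j i (-s) + Matrix.single j j (c - 1)

/-- `T` with the entries `(i, j)` and `(j, i)` replaced by zero. -/
def zeroPair {n : ℕ} (T : Matrix (Fin n) (Fin n) ℝ) (i j : Fin n) : Matrix (Fin n) (Fin n) ℝ :=
  Matrix.of fun a b => if (a = i ∧ b = j) ∨ (a = j ∧ b = i) then 0 else T a b

/-- One Jacobi update at the pivot `(i, j)` with threshold `ν`: if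
`|tᵢⱼ| ≤ ν min{|tᵢᵢ|, |tⱼⱼ|}` the entries `tᵢⱼ, tⱼᵢ` are set to zero, otherwise `T` is replaced by
`Jᵀ T J`. -/
def jacobiUpdate {n : ℕ} (ν : ℝ) (T : Matrix (Fin n) (Fin n) ℝ) (i j : Fin n) :
    Matrix (Fin n) (Fin n) ℝ :=
  if |T i j| ≤ ν * min |T i i| |T j j| then zeroPair T i j
  else
    (jacobiRotation i j (jacobiCos T i j) (jacobiSin T i j))ᵀ * T *
      jacobiRotation i j (jacobiCos T i j) (jacobiSin T i j)

/-- The pivots of one sweep in row-cyclic order: `for i = 1, …, n-1, for j = i+1, …, n`. -/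
def rowCyclicPairs (n : ℕ) : List (Fin n × Fin n) :=
  (List.finRange n).flatMap fun i =>
    ((List.finRange n).filter fun j => i < j).map fun j => (i, j)

/-- The matrix `T⁽ᵏ⁾` after the first `k` Jacobi updates of a sweep started at `T⁽⁰⁾ = T`, for
`k ≤ n (n - 1) / 2`. -/
def jacobiIterate {n : ℕ} (ν : ℝ) (T : Matrix (Fin n) (Fin n) ℝ) (k : ℕ) :
    Matrix (Fin n) (Fin n) ℝ :=
  ((rowCyclicPairs n).take k).foldl (fun S ij => jacobiUpdate ν S ij.1 ij.2) T

end MixedJacobi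

end

noncomputable section

namespace MixedJacobi

open Matrix

/-- `T'` arises from `T` by an elimination step at the pivot `(i, k)` with cosine `c` and sine `s`:
outside the pivot entry and the diagonal this is a plane rotation, the pivot entry is annihilated
and the two diagonal entries move by at most the size of the pivot entry. -/
structure IsJacobiStep {n : ℕ} (T T' : Matrix (Fin n) (Fin n) ℝ) (i k : Fin n) (c s : ℝ) :
    Prop where
  symm : T'.IsSymm
  unit : c ^ 2 + s ^ 2 = 1
  cos_nonneg : 0 ≤ c
  pivot : T' i k = 0
  col_left : ∀ m, m ≠ i → m ≠ k → T' m i = c * T m i - s * T m k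
  col_right : ∀ m, m ≠ i → m ≠ k → T' m k = s * T m i + c * T m k
  other : ∀ a b, a ≠ i → a ≠ k → b ≠ i → b ≠ k → T' a b = T a b
  diag_left : |T' i i - T i i| ≤ |T i k|
  diag_right : |T' k k - T k k| ≤ |T i k|
  sin_le : |s| * |T k k - T i i| ≤ |T i k|

theorem isJacobiStep_zeroPair {n : ℕ} {T : Matrix (Fin n) (Fin n) ℝ} (hT : T.IsSymm)
    {i k : Fin n} (hik : i ≠ k) : IsJacobiStep T (zeroPair T i k) i k 1 0 where
  symm := by
    ext a b
    have := hT.apply a b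
    simp only [zeroPair, Matrix.transpose_apply, Matrix.of_apply]
    rw [this]
    congr 1
    simp only [eq_iff_iff]
    tauto
  unit := by norm_num
  cos_nonneg := by norm_num
  pivot := by simp [zeroPair]
  col_left m h1 h2 := by simp [zeroPair, h1, h2]
  col_right m h1 h2 := by simp [zeroPair, h1, h2]
  other a b h1 h2 h3 h4 := by simp [zeroPair, h1, h2]
  diag_left := by simp [zeroPair, hik]
  diag_right := by simp [zeroPair, hik.symm]
  sin_le := by simp

theorem mul_jacobiRotation_apply {n : ℕ} (M : Matrix (Fin n) (Fin n) ℝ) (i k : Fin n) (c s : ℝ)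
    (a b : Fin n) :
    (M * jacobiRotation i k c s) a b =
      M a b + (if b = i then M a i * (c - 1) - M a k * s else 0) +
        (if b = k then M a i * s + M a k * (c - 1) else 0) := by
  have h : ∀ (p q : Fin n) (x : ℝ),
      (M * Matrix.single p q x) a b = if b = q then M a p * x else 0 := by
    intro p q x
    split_ifs with hb
    · subst hb; simp
    · exact Matrix.mul_single_apply_of_ne _ _ _ _ _ hb _
  simp only [jacobiRotation, mul_add, Matrix.add_apply, h, mul_one]
  split_ifs <;> ring

theorem conj_jacobiRotation_apply {n : ℕ} (T : Matrix (Fin n) (Fin n) ℝ)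
    (i k : Fin n) (c s : ℝ) (a b : Fin n) :
    ((jacobiRotation i k c s)ᵀ * T * jacobiRotation i k c s) a b =
      (T * jacobiRotation i k c s) a b +
      (if a = i then (T * jacobiRotation i k c s) i b * (c - 1)
        - (T * jacobiRotation i k c s) k b * s else 0) +
      (if a = k then (T * jacobiRotation i k c s) i b * s
        + (T * jacobiRotation i k c s) k b * (c - 1) else 0) := by
  have h : (jacobiRotation i k c s)ᵀ * T * jacobiRotation i k c s =
      ((T * jacobiRotation i k c s)ᵀ * jacobiRotation i k c s)ᵀ := by
    rw [Matrix.transpose_mul, Matrix.transpose_transpose, Matrix.mul_assoc]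
  rw [h, Matrix.transpose_apply, mul_jacobiRotation_apply]
  simp only [Matrix.transpose_apply]

theorem isJacobiStep_conj {n : ℕ} {T : Matrix (Fin n) (Fin n) ℝ} (hT : T.IsSymm)
    {i k : Fin n} (hik : i ≠ k) {c t : ℝ} (hc : 0 ≤ c) (h1 : c ^ 2 + (t * c) ^ 2 = 1)
    (ht : |t| ≤ 1) (hroot : t * (T k k - T i i) = (1 - t ^ 2) * T i k)
    (hgap : |t| * |T k k - T i i| ≤ |T i k|) :
    IsJacobiStep T ((jacobiRotation i k c (t * c))ᵀ * T * jacobiRotation i k c (t * c))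
      i k c (t * c) := by
  have hki := hT.apply i k
  have hc1 : |c| ≤ 1 := by
    rw [abs_le]; constructor <;> nlinarith [sq_nonneg (t * c)]
  have hdiag1 : ((jacobiRotation i k c (t * c))ᵀ * T * jacobiRotation i k c (t * c)) i i - T i i
      = - t * T i k := by
    simp only [conj_jacobiRotation_apply T, mul_jacobiRotation_apply, hik, if_true,
      if_false, hki]
    linear_combination (T i i - t * T i k) * h1 + c ^ 2 * t * hroot
  have hdiag2 : ((jacobiRotation i k c (t * c))ᵀ * T * jacobiRotation i k c (t * c)) k k - T k k
      = t * T i k := by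
    simp only [conj_jacobiRotation_apply T, mul_jacobiRotation_apply, hik.symm, if_true,
      if_false, hki]
    linear_combination (T k k + t * T i k) * h1 - c ^ 2 * t * hroot
  have hle : |t * T i k| ≤ |T i k| := by
    rw [abs_mul]
    exact mul_le_of_le_one_left (abs_nonneg _) ht
  refine ⟨?_, h1, hc, ?_, ?_, ?_, ?_, ?_, ?_, ?_⟩
  · unfold Matrix.IsSymm
    rw [Matrix.transpose_mul, Matrix.transpose_mul, Matrix.transpose_transpose, hT.eq,
      Matrix.mul_assoc]
  · simp only [conj_jacobiRotation_apply T, mul_jacobiRotation_apply, hik, hik.symm, if_true,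
      if_false, hki]
    linear_combination (-c ^ 2) * hroot
  · intro m hm1 hm2
    simp only [conj_jacobiRotation_apply T, mul_jacobiRotation_apply, hik, hm1, hm2, if_true,
      if_false]
    ring
  · intro m hm1 hm2
    simp only [conj_jacobiRotation_apply T, mul_jacobiRotation_apply, hik.symm, hm1, hm2, if_true,
      if_false]
    ring
  · intro a b h1 h2 h3 h4
    simp only [conj_jacobiRotation_apply T, mul_jacobiRotation_apply, h1, h2, h3, h4, if_false]
    ring
  · rw [hdiag1, neg_mul, abs_neg]; exact hle
  · rw [hdiag2]; exact hle
  · refine le_trans ?_ hgap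
    refine mul_le_mul_of_nonneg_right ?_ (abs_nonneg _)
    rw [abs_mul]
    exact mul_le_of_le_one_right (abs_nonneg _) hc1

theorem jacobiTan_spec {n : ℕ} (T : Matrix (Fin n) (Fin n) ℝ) (i k : Fin n) (h : T i k ≠ 0) :
    |jacobiTan T i k| ≤ 1 ∧
    jacobiTan T i k * (T k k - T i i) = (1 - jacobiTan T i k ^ 2) * T i k ∧
    |jacobiTan T i k| * |T k k - T i i| ≤ |T i k| := by
  set μ := (T k k - T i i) / (2 * T i k) with hμ
  have hd : T k k - T i i = 2 * μ * T i k := by rw [hμ]; field_simp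
  have hs : Real.sqrt (1 + μ ^ 2) ^ 2 = 1 + μ ^ 2 := Real.sq_sqrt (by positivity)
  have hs1 : 1 ≤ Real.sqrt (1 + μ ^ 2) := by
    rw [Real.one_le_sqrt]; nlinarith [sq_nonneg μ]
  set r := Real.sqrt (1 + μ ^ 2) with hr
  have key : ∃ t, jacobiTan T i k = t ∧ |t| ≤ 1 ∧ t * (2 * μ) = 1 - t ^ 2 ∧ |t| * |2 * μ| ≤ 1 := by
    refine ⟨_, rfl, ?_⟩
    unfold jacobiTan
    simp only [← hμ, ← hr]
    split_ifs with h0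
    · have hp : 0 < μ + r := by linarith
      have hroot : 1 / (μ + r) * (2 * μ) = 1 - (1 / (μ + r)) ^ 2 := by
        field_simp; nlinarith
      have hpos : 0 < 1 / (μ + r) := by positivity
      refine ⟨?_, hroot, ?_⟩
      · rw [abs_of_pos hpos, div_le_one hp]; linarith
      · rw [abs_of_pos hpos, abs_of_nonneg (by linarith), hroot]
        nlinarith [sq_nonneg (1 / (μ + r))]
    · push Not at h0
      have hp : μ - r < 0 := by linarith
      have hne : μ - r ≠ 0 := hp.ne
      have hroot : 1 / (μ - r) * (2 * μ) = 1 - (1 / (μ - r)) ^ 2 := by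
        field_simp; nlinarith
      have hneg : 1 / (μ - r) < 0 := one_div_neg.mpr hp
      refine ⟨?_, hroot, ?_⟩
      · rw [abs_of_neg hneg, ← one_div_neg_eq_neg_one_div, div_le_one (by linarith)]; linarith
      · rw [← abs_mul, hroot, abs_le]
        have : (1 / (μ - r)) ^ 2 ≤ 1 := by
          rw [div_pow, one_pow, div_le_one (by positivity)]; nlinarith
        constructor <;> nlinarith [sq_nonneg (1 / (μ - r))]
  obtain ⟨t, ht, h1, h2, h3⟩ := key
  rw [ht, hd]
  refine ⟨h1, ?_, ?_⟩
  · rw [← h2]; ring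
  · rw [abs_mul, ← mul_assoc]
    exact mul_le_of_le_one_left (abs_nonneg _) h3

theorem exists_isJacobiStep_jacobiUpdate {n : ℕ} (ν : ℝ) {T : Matrix (Fin n) (Fin n) ℝ}
    (hT : T.IsSymm) {i k : Fin n} (hik : i ≠ k) :
    ∃ c s, IsJacobiStep T (jacobiUpdate ν T i k) i k c s := by
  unfold jacobiUpdate
  split_ifs with h
  · exact ⟨1, 0, isJacobiStep_zeroPair hT hik⟩
  · by_cases h0 : T i k = 0
    · refine ⟨1, 0 * 1, ?_⟩
      have hs : jacobiSin T i k = 0 * 1 := by simp [jacobiSin, h0]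
      have hc : jacobiCos T i k = 1 := by simp [jacobiCos, h0]
      rw [hs, hc]
      exact isJacobiStep_conj hT hik zero_le_one (by norm_num) (by norm_num) (by simp [h0])
        (by simp)
    · obtain ⟨h1, h2, h3⟩ := jacobiTan_spec T i k h0
      have hs : jacobiSin T i k = jacobiTan T i k * jacobiCos T i k := by simp [jacobiSin, h0]
      have hc : jacobiCos T i k = 1 / Real.sqrt (1 + jacobiTan T i k ^ 2) := by
        simp [jacobiCos, h0]
      refine ⟨jacobiCos T i k, jacobiTan T i k * jacobiCos T i k, ?_⟩
      rw [hs]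
      refine isJacobiStep_conj hT hik (by rw [hc]; positivity) ?_ h1 h2 h3
      have : jacobiCos T i k ^ 2 = 1 / (1 + jacobiTan T i k ^ 2) := by
        rw [hc, div_pow, Real.sq_sqrt (by positivity), one_pow]
      rw [mul_pow, this]
      field_simp

/-! ### Sums of squares of the entries in a set of positions -/

open Classical in
/-- The sum of the squares of the entries of `T` at the positions `(a, b)` with `P a b`. -/
def energy {n : ℕ} (P : Fin n → Fin n → Prop) (T : Matrix (Fin n) (Fin n) ℝ) : ℝ :=
  ∑ a, ∑ b, if P a b then T a b ^ 2 else 0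

/-- Off-diagonal positions in the rows and columns `p, …, k - 1`. -/
def InBox {n : ℕ} (p k : ℕ) (a b : Fin n) : Prop :=
  a ≠ b ∧ (p ≤ a ∧ (a : ℕ) < k) ∧ (p ≤ b ∧ (b : ℕ) < k)

/-- Off-diagonal positions in the rows and columns from `p` on, inside the clusters of `cl`. -/
def InCluster {n : ℕ} (cl : Fin n → ℝ) (p : ℕ) (a b : Fin n) : Prop :=
  a ≠ b ∧ cl a = cl b ∧ p ≤ a ∧ p ≤ b

theorem energy_nonneg {n : ℕ} (P : Fin n → Fin n → Prop) (T : Matrix (Fin n) (Fin n) ℝ) :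
    0 ≤ energy P T := by
  unfold energy
  refine Finset.sum_nonneg fun a _ => Finset.sum_nonneg fun b _ => ?_
  split_ifs <;> positivity

theorem sq_le_energy {n : ℕ} {P : Fin n → Fin n → Prop} (T : Matrix (Fin n) (Fin n) ℝ)
    {a b : Fin n} (h : P a b) : T a b ^ 2 ≤ energy P T := by
  classical
  have h0 : ∀ a b, (0 : ℝ) ≤ if P a b then T a b ^ 2 else 0 := by
    intro a b; split_ifs <;> positivity
  have h1 := Finset.single_le_sum (f := fun b => if P a b then T a b ^ 2 else 0)
    (fun b _ => h0 a b) (Finset.mem_univ b)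
  have h2 := Finset.single_le_sum (f := fun a => ∑ b, if P a b then T a b ^ 2 else 0)
    (fun a _ => Finset.sum_nonneg fun b _ => h0 a b) (Finset.mem_univ a)
  simp only [h, if_true] at h1
  unfold energy
  exact h1.trans (by convert h2)

/-- Adding one row and the corresponding column to a symmetric set of positions. -/
theorem energy_eq_add {n : ℕ} {P P' : Fin n → Fin n → Prop} {T : Matrix (Fin n) (Fin n) ℝ}
    (hT : T.IsSymm) (r : Fin n) (K : Finset (Fin n)) (hr : r ∉ K)
    (h : ∀ a b, P' a b ↔ P a b ∨ (a = r ∧ b ∈ K) ∨ (b = r ∧ a ∈ K))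
    (hP : ∀ b, ¬ P r b) (hP' : ∀ a, ¬ P a r) :
    energy P' T = energy P T + 2 * ∑ m ∈ K, T r m ^ 2 := by
  classical
  have hsplit : ∀ a b, (if P' a b then T a b ^ 2 else 0) = (if P a b then T a b ^ 2 else 0) +
      (if a = r then (if b ∈ K then T r b ^ 2 else 0) else 0) +
      (if b = r then (if a ∈ K then T r a ^ 2 else 0) else 0) := by
    intro a b
    by_cases ha : a = r
    · subst ha
      by_cases hb : b = a
      · subst hb; simp [h, hP, hr]
      · simp [h, hP, hr, hb]
    · by_cases hb : b = r
      · subst hb; simp [h, hP', ha, hT.apply b a]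
      · simp [h, ha, hb]
  unfold energy
  simp only [hsplit, Finset.sum_add_distrib]
  have e1 : ∑ a, ∑ b, (if a = r then (if b ∈ K then T r b ^ 2 else 0) else 0) =
      ∑ m ∈ K, T r m ^ 2 := by
    rw [Finset.sum_comm]; simp
  have e2 : ∑ a, ∑ b, (if b = r then (if a ∈ K then T r a ^ 2 else 0) else 0) =
      ∑ m ∈ K, T r m ^ 2 := by
    simp
  rw [e1, e2]; ring

/-- A step removes twice the square of the pivot entry from the energy of every symmetric set of
positions that does not separate the two pivot indices. -/
theorem IsJacobiStep.energy_eq {n : ℕ} {T T' : Matrix (Fin n) (Fin n) ℝ} {i k : Fin n} {c s : ℝ}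
    (hs : IsJacobiStep T T' i k c s) (hT : T.IsSymm) (hik : i ≠ k) {P : Fin n → Fin n → Prop}
    (hP : ∀ a b, P a b ↔ P b a) (hi : ¬ P i i) (hk : ¬ P k k)
    (h : ∀ a, a ≠ i → a ≠ k → (P a i ↔ P a k)) (hp : P i k) :
    energy P T' = energy P T - 2 * T i k ^ 2 := by
  classical
  set f : Fin n → Fin n → ℝ := fun a b => if P a b then T' a b ^ 2 - T a b ^ 2 else 0 with hf
  have hE : energy P T' - energy P T = ∑ a, ∑ b, f a b := by
    unfold energy
    rw [← Finset.sum_sub_distrib]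
    refine Finset.sum_congr rfl fun a _ => ?_
    rw [← Finset.sum_sub_distrib]
    refine Finset.sum_congr rfl fun b _ => ?_
    simp only [hf]
    split_ifs <;> simp
  have hfs : ∀ a b, f a b = f b a := by
    intro a b
    simp only [hf, hP a b, hT.apply a b, hs.symm.apply a b]
  have hcol : ∀ a, a ≠ i → a ≠ k → f a i + f a k = 0 := by
    intro a h1 h2
    simp only [hf, h a h1 h2]
    split_ifs
    · rw [hs.col_left a h1 h2, hs.col_right a h1 h2]
      linear_combination (T a i ^ 2 + T a k ^ 2) * hs.unit
    · simp
  have hrow : ∀ a, a ≠ i ∧ a ≠ k → ∑ b, f a b = 0 := by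
    rintro a ⟨h1, h2⟩
    rw [Fintype.sum_eq_add i k hik, hcol a h1 h2]
    rintro x ⟨h3, h4⟩
    simp [hf, hs.other a x h1 h2 h3 h4]
  have htot : ∑ a, ∑ b, f a b = - 2 * T i k ^ 2 := by
    rw [Fintype.sum_eq_add i k hik hrow, ← Finset.sum_add_distrib, Fintype.sum_eq_add i k hik]
    · have h1 : f i i = 0 := by simp [hf, hi]
      have h2 : f k k = 0 := by simp [hf, hk]
      have h3 : f i k = - T i k ^ 2 := by simp [hf, hp, hs.pivot]
      rw [hfs k i, h1, h2, h3]; ring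
    · rintro x ⟨h1, h2⟩
      rw [hfs i x, hfs k x, hcol x h1 h2]
  linarith

/-! ### Inequalities for finite sums -/

theorem sum_add_sq_le {ι : Type*} (t : Finset ι) (f g : ι → ℝ) {A B : ℝ} (hA : 0 ≤ A) (hB : 0 ≤ B)
    (hf : ∑ x ∈ t, f x ^ 2 ≤ A ^ 2) (hg : ∑ x ∈ t, g x ^ 2 ≤ B ^ 2) :
    ∑ x ∈ t, (f x + g x) ^ 2 ≤ (A + B) ^ 2 := by
  have h1 := Finset.sum_mul_sq_le_sq_mul_sq t f g
  have h2 : (∑ x ∈ t, f x * g x) ^ 2 ≤ (A * B) ^ 2 := by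
    refine h1.trans ?_
    rw [mul_pow]
    exact mul_le_mul hf hg (Finset.sum_nonneg fun _ _ => sq_nonneg _) (sq_nonneg _)
  have h3 : ∑ x ∈ t, f x * g x ≤ A * B := (le_abs_self _).trans (abs_le_of_sq_le_sq h2 (by positivity))
  have h4 : ∑ x ∈ t, (f x + g x) ^ 2 =
      ∑ x ∈ t, f x ^ 2 + 2 * ∑ x ∈ t, f x * g x + ∑ x ∈ t, g x ^ 2 := by
    rw [Finset.mul_sum, ← Finset.sum_add_distrib, ← Finset.sum_add_distrib]
    exact Finset.sum_congr rfl fun x _ => by ring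
  rw [h4]; nlinarith

/-! ### One row of the sweep -/

/-- `M k` is the matrix before the pivot `(i, k)` while row `i` of the sweep is processed. -/
structure IsRowSweep {n : ℕ} (i : Fin n) (M : ℕ → Matrix (Fin n) (Fin n) ℝ) (c s : Fin n → ℝ) :
    Prop where
  symm : ∀ k, (M k).IsSymm
  skip : ∀ k : Fin n, k ≤ i → M (k + 1) = M k
  step : ∀ k : Fin n, i < k → IsJacobiStep (M k) (M (k + 1)) i k (c k) (s k)

/-- The indices right of `i` and left of `k`. -/
def between {n : ℕ} (i : Fin n) (k : ℕ) : Finset (Fin n) :=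
  Finset.univ.filter fun m => i < m ∧ (m : ℕ) < k

theorem mem_between {n : ℕ} {i : Fin n} {k : ℕ} {m : Fin n} :
    m ∈ between i k ↔ i < m ∧ (m : ℕ) < k := by simp [between]

theorem sum_fin_sub {n : ℕ} (f : ℕ → ℝ) : ∑ k : Fin n, (f (k + 1) - f k) = f n - f 0 := by
  rw [Fin.sum_univ_eq_sum_range (fun k => f (k + 1) - f k), Finset.sum_range_sub]

theorem sum_ite_lt_eq_sum_Ioi {n : ℕ} (i : Fin n) (f : Fin n → ℝ) :
    ∑ k, (if i < k then f k else 0) = ∑ k ∈ Finset.Ioi i, f k := by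
  rw [← Finset.sum_filter]
  exact Finset.sum_congr (by ext; simp) fun _ _ => rfl

theorem InBox.symm_iff {n : ℕ} (p k : ℕ) (a b : Fin n) : InBox p k a b ↔ InBox p k b a := by
  unfold InBox; tauto

theorem IsRowSweep.energy_inBox {n : ℕ} {i : Fin n} {M : ℕ → Matrix (Fin n) (Fin n) ℝ}
    {c s : Fin n → ℝ} (hM : IsRowSweep i M c s) {p : ℕ} (hp : p ≤ i) :
    energy (InBox p n) (M n) =
      energy (InBox p n) (M 0) - 2 * ∑ k ∈ Finset.Ioi i, M k i k ^ 2 := by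
  have h := sum_fin_sub (n := n) fun k => energy (InBox p n) (M k)
  have h2 : ∀ k : Fin n, energy (InBox p n) (M (k + 1)) - energy (InBox p n) (M k) =
      if i < k then -2 * M k i k ^ 2 else 0 := by
    intro k
    split_ifs with hk
    · rw [(hM.step k hk).energy_eq (hM.symm k) hk.ne (InBox.symm_iff p n) (by simp [InBox])
        (by simp [InBox])]
      · ring
      · intro a h1 h2
        have : (i : ℕ) < k := hk
        simp only [InBox, ne_eq, h1, h2, not_false_eq_true, true_and]
        have := i.2; have := k.2
        omega
      · have : (i : ℕ) < k := hk
        refine ⟨hk.ne, ⟨hp, i.2⟩, ?_, k.2⟩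
        omega
    · rw [hM.skip k (not_lt.mp hk), sub_self]
  simp only [h2] at h
  rw [sum_ite_lt_eq_sum_Ioi, ← Finset.mul_sum] at h
  linarith

theorem energy_inBox_succ_right {n : ℕ} {i k : Fin n} (hik : i < k) {T : Matrix (Fin n) (Fin n) ℝ}
    (hT : T.IsSymm) :
    energy (InBox i (k + 1)) T =
      energy (InBox i k) T + 2 * (T i k ^ 2 + ∑ m ∈ between i k, T m k ^ 2) := by
  classical
  have hik' : (i : ℕ) < k := hik
  rw [energy_eq_add (P := InBox i k) (P' := InBox i (k + 1)) hT k
    (insert i (between i k))]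
  · rw [Finset.sum_insert (by simp [mem_between]), hT.apply i k]
    refine congrArg (fun x => _ + 2 * (_ + x)) (Finset.sum_congr rfl fun m _ => ?_)
    rw [hT.apply m k]
  · simp [mem_between, hik.ne']
  · intro a b
    simp only [InBox, ne_eq, Fin.ext_iff, Fin.lt_def, Finset.mem_insert, mem_between]
    omega
  · simp [InBox]
  · simp [InBox]

theorem energy_inBox_empty {n : ℕ} {p k : ℕ} (h : k ≤ p + 1) (T : Matrix (Fin n) (Fin n) ℝ) :
    energy (InBox p k) T = 0 := by
  unfold energy
  refine Finset.sum_eq_zero fun a _ => Finset.sum_eq_zero fun b _ => ?_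
  rw [if_neg]
  simp only [InBox, ne_eq, Fin.ext_iff]
  omega

theorem IsRowSweep.sum_columns {n : ℕ} {i : Fin n} {M : ℕ → Matrix (Fin n) (Fin n) ℝ}
    {c s : Fin n → ℝ} (hM : IsRowSweep i M c s) :
    ∑ k ∈ Finset.Ioi i, ∑ m ∈ between i k, M k m k ^ 2 =
      energy (InBox i n) (M 0) / 2 - ∑ k ∈ Finset.Ioi i, M k i k ^ 2 := by
  have h := sum_fin_sub (n := n) fun k => energy (InBox i k) (M k)
  have h2 : ∀ k : Fin n, energy (InBox i (k + 1)) (M (k + 1)) - energy (InBox i k) (M k) =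
      if i < k then 2 * ∑ m ∈ between i k, M k m k ^ 2 else 0 := by
    intro k
    split_ifs with hk
    · have hk' : (i : ℕ) < k := hk
      rw [(hM.step k hk).energy_eq (hM.symm k) hk.ne (InBox.symm_iff i (k + 1)) (by simp [InBox])
        (by simp [InBox]), energy_inBox_succ_right hk (hM.symm k)]
      · ring
      · intro a h1 h2
        simp only [InBox, ne_eq, h1, h2, not_false_eq_true, true_and]
        omega
      · refine ⟨hk.ne, ?_, ?_⟩ <;> omega
    · have : (k : ℕ) ≤ i := not_lt.mp hk
      rw [energy_inBox_empty (by omega), energy_inBox_empty (by omega), sub_self]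
  simp only [h2] at h
  rw [sum_ite_lt_eq_sum_Ioi, ← Finset.mul_sum, energy_inBox_empty (k := 0) (by omega),
    hM.energy_inBox le_rfl] at h
  linarith

/-- The part of row `i` that has been visited before the pivot `(i, k)`. -/
def visitedNorm {n : ℕ} (i : Fin n) (M : ℕ → Matrix (Fin n) (Fin n) ℝ) (k : ℕ) : ℝ :=
  Real.sqrt (∑ m ∈ between i k, M k i m ^ 2)

theorem visitedNorm_sq {n : ℕ} (i : Fin n) (M : ℕ → Matrix (Fin n) (Fin n) ℝ) (k : ℕ) :
    visitedNorm i M k ^ 2 = ∑ m ∈ between i k, M k i m ^ 2 :=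
  Real.sq_sqrt (Finset.sum_nonneg fun _ _ => sq_nonneg _)

theorem IsJacobiStep.abs_cos_le {n : ℕ} {T T' : Matrix (Fin n) (Fin n) ℝ} {i k : Fin n} {c s : ℝ}
    (hs : IsJacobiStep T T' i k c s) : |c| ≤ 1 := by
  rw [← sq_le_one_iff_abs_le_one]
  nlinarith [hs.unit, sq_nonneg s]

theorem IsJacobiStep.abs_sin_le {n : ℕ} {T T' : Matrix (Fin n) (Fin n) ℝ} {i k : Fin n} {c s : ℝ}
    (hs : IsJacobiStep T T' i k c s) : |s| ≤ 1 := by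
  rw [← sq_le_one_iff_abs_le_one]
  nlinarith [hs.unit, sq_nonneg c]

theorem IsJacobiStep.one_sub_cos_le {n : ℕ} {T T' : Matrix (Fin n) (Fin n) ℝ} {i k : Fin n}
    {c s : ℝ} (hs : IsJacobiStep T T' i k c s) : |c - 1| ≤ |s| := by
  have h1 := hs.abs_cos_le
  have h2 := hs.abs_sin_le
  rw [abs_of_nonneg hs.cos_nonneg] at h1
  rw [abs_of_nonpos (by linarith)]
  have := hs.unit
  have := hs.cos_nonneg
  have := abs_nonneg s
  rw [← sq_abs s] at *
  nlinarith

theorem IsRowSweep.visitedNorm_succ {n : ℕ} {i : Fin n} {M : ℕ → Matrix (Fin n) (Fin n) ℝ}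
    {c s : Fin n → ℝ} (hM : IsRowSweep i M c s) (k : Fin n) (hk : i < k) :
    visitedNorm i M (k + 1) ≤ visitedNorm i M k +
      |s k| * Real.sqrt (∑ m ∈ between i k, M k m k ^ 2) := by
  have hs := hM.step k hk
  have hbt : between i (k + 1) = insert k (between i k) := by
    ext m
    simp only [mem_between, Finset.mem_insert, Fin.lt_def, Fin.ext_iff] at hk ⊢
    omega
  have hsum : ∑ m ∈ between i (k + 1), M (k + 1) i m ^ 2 =
      ∑ m ∈ between i k, (c k * M k i m + -(s k * M k m k)) ^ 2 := by
    rw [hbt, Finset.sum_insert (by simp [mem_between]), hs.pivot]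
    simp only [ne_eq, OfNat.ofNat_ne_zero, not_false_eq_true, zero_pow, zero_add]
    refine Finset.sum_congr rfl fun m hm => ?_
    rw [mem_between] at hm
    have h1 : m ≠ i := hm.1.ne'
    have h2 : m ≠ k := fun h => by rw [h] at hm; exact lt_irrefl _ hm.2
    rw [← hs.symm.apply i m, hs.col_left m h1 h2, (hM.symm k).apply i m]
    ring
  have hc := hs.abs_cos_le
  refine Real.sqrt_le_iff.mpr ⟨by unfold visitedNorm; positivity, ?_⟩
  rw [hsum]
  refine sum_add_sq_le _ _ _ (Real.sqrt_nonneg _) (by positivity) ?_ ?_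
  · rw [visitedNorm_sq]
    refine Finset.sum_le_sum fun m _ => ?_
    rw [mul_pow]
    exact mul_le_of_le_one_left (sq_nonneg _) ((sq_le_one_iff_abs_le_one _).mpr hc)
  · rw [mul_pow, sq_abs, Real.sq_sqrt (Finset.sum_nonneg fun _ _ => sq_nonneg _),
      Finset.mul_sum]
    exact le_of_eq (Finset.sum_congr rfl fun m _ => by ring)

/-- The norm of a finished row: what the pivots left of `b` leave behind, plus the refill. -/
theorem IsRowSweep.visitedNorm_le {n : ℕ} {i : Fin n} {M : ℕ → Matrix (Fin n) (Fin n) ℝ}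
    {c s : Fin n → ℝ} (hM : IsRowSweep i M c s) {b : ℕ} (hib : (i : ℕ) < b) (hbn : b ≤ n) {d : ℝ}
    (hd : 0 < d) (hsin : ∀ k : Fin n, b ≤ k → |s k| ≤ |M k i k| / d) :
    visitedNorm i M n ≤ visitedNorm i M b +
      Real.sqrt ((∑ k ∈ Finset.Ioi i, M k i k ^ 2) *
        (energy (InBox i n) (M 0) / 2 - ∑ k ∈ Finset.Ioi i, M k i k ^ 2)) / d := by
  classical
  set col : Fin n → ℝ := fun k => Real.sqrt (∑ m ∈ between i k, M k m k ^ 2) with hcol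
  set out : Finset (Fin n) := Finset.univ.filter fun k => b ≤ (k : ℕ) with hout
  have hsub : out ⊆ Finset.Ioi i := by
    intro k hk
    simp only [hout, Finset.mem_filter, Finset.mem_univ, true_and] at hk
    simp only [Finset.mem_Ioi, Fin.lt_def]
    omega
  have h1 : visitedNorm i M n - visitedNorm i M b ≤ ∑ k ∈ out, |s k| * col k := by
    have h := sum_fin_sub (n := n) fun k => visitedNorm i M (max k b)
    simp only [max_eq_left hbn, Nat.zero_le, max_eq_right] at h
    rw [← h, hout, Finset.sum_filter]
    refine Finset.sum_le_sum fun k _ => ?_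
    split_ifs with hk
    · rw [max_eq_left hk, max_eq_left (by omega)]
      have := hM.visitedNorm_succ k (by rw [Fin.lt_def]; omega)
      linarith
    · rw [max_eq_right (by omega), max_eq_right (by omega), sub_self]
  have hcolsq : ∀ k, col k ^ 2 = ∑ m ∈ between i k, M k m k ^ 2 := fun k =>
    Real.sq_sqrt (Finset.sum_nonneg fun _ _ => sq_nonneg _)
  have h2 : ∑ k ∈ out, |s k| ^ 2 ≤ (∑ k ∈ Finset.Ioi i, M k i k ^ 2) / d ^ 2 := by
    rw [Finset.sum_div]
    refine (Finset.sum_le_sum fun k hk => ?_).trans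
      (Finset.sum_le_sum_of_subset_of_nonneg hsub fun _ _ _ => by positivity)
    have := pow_le_pow_left₀ (abs_nonneg _) (hsin k (by simpa [hout] using hk)) 2
    rwa [div_pow, sq_abs (M k i k)] at this
  have h3 : ∑ k ∈ out, col k ^ 2 ≤
      energy (InBox i n) (M 0) / 2 - ∑ k ∈ Finset.Ioi i, M k i k ^ 2 := by
    rw [← hM.sum_columns]
    simp only [hcolsq]
    exact Finset.sum_le_sum_of_subset_of_nonneg hsub fun _ _ _ =>
      Finset.sum_nonneg fun _ _ => sq_nonneg _
  have h4 := Finset.sum_mul_sq_le_sq_mul_sq out (fun k => |s k|) col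
  have h5 : ∑ k ∈ out, |s k| * col k ≤
      Real.sqrt ((∑ k ∈ Finset.Ioi i, M k i k ^ 2) *
        (energy (InBox i n) (M 0) / 2 - ∑ k ∈ Finset.Ioi i, M k i k ^ 2)) / d := by
    rw [le_div_iff₀ hd]
    refine Real.le_sqrt_of_sq_le ?_
    rw [mul_pow]
    calc _ ≤ ((∑ k ∈ out, |s k| ^ 2) * ∑ k ∈ out, col k ^ 2) * d ^ 2 := by gcongr
      _ ≤ (((∑ k ∈ Finset.Ioi i, M k i k ^ 2) / d ^ 2) *
          (energy (InBox i n) (M 0) / 2 - ∑ k ∈ Finset.Ioi i, M k i k ^ 2)) * d ^ 2 := by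
        have h0 : (0 : ℝ) ≤ ∑ k ∈ out, col k ^ 2 := Finset.sum_nonneg fun _ _ => sq_nonneg _
        gcongr
      _ = _ := by field_simp
  linarith

theorem between_eq_Ioi {n : ℕ} (i : Fin n) : between i n = Finset.Ioi i := by
  ext m; simp [mem_between]

theorem energy_inBox_succ_left {n : ℕ} (i : Fin n) {T : Matrix (Fin n) (Fin n) ℝ}
    (hT : T.IsSymm) :
    energy (InBox i n) T =
      energy (InBox (i + 1) n) T + 2 * ∑ m ∈ Finset.Ioi i, T i m ^ 2 := by
  classical
  rw [energy_eq_add (P := InBox (i + 1) n) (P' := InBox i n) hT i (Finset.Ioi i)]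
  · simp
  · intro a b
    have := a.2; have := b.2
    simp only [InBox, ne_eq, Fin.ext_iff, Finset.mem_Ioi, Fin.lt_def]
    omega
  · simp [InBox]
  · simp [InBox]

/-! ### The entries inside the clusters -/

theorem IsRowSweep.energy_inCluster {n : ℕ} {i : Fin n} {M : ℕ → Matrix (Fin n) (Fin n) ℝ}
    {c s : Fin n → ℝ} (hM : IsRowSweep i M c s) {cl : Fin n → ℝ} {b : ℕ} (hbn : b ≤ n)
    (hcl : ∀ k, i < k → (cl k = cl i ↔ (k : ℕ) < b)) :
    energy (InCluster cl i) (M b) ≤ energy (InCluster cl i) (M 0) := by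
  have key : ∀ k : ℕ, k ≤ b →
      energy (InCluster cl i) (M k) ≤ energy (InCluster cl i) (M 0) := by
    intro k
    induction k with
    | zero => intro _; exact le_rfl
    | succ k ih =>
      intro hk
      refine le_trans ?_ (ih (by omega))
      by_cases hik : (i : ℕ) < k
      · have hs := hM.step ⟨k, by omega⟩ hik
        have hck := (hcl ⟨k, by omega⟩ hik).mpr (by simp only []; omega)
        have hne : i ≠ ⟨k, by omega⟩ := ne_of_lt hik
        rw [hs.energy_eq (hM.symm k) hne (P := InCluster cl i)
          (fun a b => by unfold InCluster; tauto) (by simp [InCluster]) (by simp [InCluster])]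
        · nlinarith [sq_nonneg (M k i ⟨k, by omega⟩)]
        · intro a h1 h2
          simp only [InCluster, ne_eq, h1, h2, hck, not_false_eq_true, true_and, le_refl]
          refine and_congr_right fun _ => and_congr_right fun _ => ?_
          simp only [true_iff]; omega
        · exact ⟨hne, hck.symm, le_rfl, by simp only []; omega⟩
      · exact le_of_eq (by rw [show M (k + 1) = M k from hM.skip ⟨k, by omega⟩ (by
          rw [Fin.le_def]; simp only []; omega)])
  exact key b le_rfl

theorem energy_inCluster_eq_add {n : ℕ} {i : Fin n} {M : ℕ → Matrix (Fin n) (Fin n) ℝ}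
    {cl : Fin n → ℝ} {b : ℕ} (hM : (M b).IsSymm)
    (hcl : ∀ k, i < k → (cl k = cl i ↔ (k : ℕ) < b)) :
    energy (InCluster cl i) (M b) =
      energy (InCluster cl (i + 1)) (M b) + 2 * visitedNorm i M b ^ 2 := by
  classical
  rw [visitedNorm_sq, energy_eq_add (P := InCluster cl (i + 1)) (P' := InCluster cl i) hM i
    (between i b)]
  · simp [mem_between]
  · intro a b'
    have hmem : ∀ m, m ∈ between i b ↔ i < m ∧ cl m = cl i := fun m => by
      rw [mem_between]; exact and_congr_right fun h => (hcl m h).symm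
    simp only [InCluster, ne_eq, hmem, Fin.lt_def]
    clear hmem hcl hM
    clear b
    rename' b' => b
    by_cases ha : a = i
    · subst ha
      by_cases hb : b = a
      · subst hb; simp
      · have : (b : ℕ) ≠ a := fun h => hb (Fin.ext h)
        simp only [hb, Ne.symm hb, not_false_eq_true, le_refl, true_and, false_and, or_false,
          eq_comm (a := cl b)]
        constructor
        · rintro ⟨h1, h2⟩; exact Or.inr ⟨by omega, h1⟩
        · rintro (⟨h1, h2, h3⟩ | ⟨h1, h2⟩)
          · omega
          · exact ⟨h2, by omega⟩
    · have ha' : (a : ℕ) ≠ i := fun h => ha (Fin.ext h)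
      by_cases hb : b = i
      · subst hb
        simp only [ha, not_false_eq_true, le_refl, true_and, false_and, false_or, and_true]
        constructor
        · rintro ⟨h1, h2⟩; exact Or.inr ⟨by omega, h1⟩
        · rintro (⟨h1, h2, h3⟩ | ⟨h1, h2⟩)
          · omega
          · exact ⟨h2, by omega⟩
      · have hb' : (b : ℕ) ≠ i := fun h => hb (Fin.ext h)
        simp only [ha, hb, false_and, or_false]
        refine and_congr_right fun _ => and_congr_right fun _ => ?_
        omega
  · simp [InCluster]
  · simp [InCluster]

theorem IsRowSweep.step_nat {n : ℕ} {i : Fin n} {M : ℕ → Matrix (Fin n) (Fin n) ℝ}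
    {c s : Fin n → ℝ} (hM : IsRowSweep i M c s) {j : ℕ} (hj : j < n) (hij : (i : ℕ) < j) :
    IsJacobiStep (M j) (M (j + 1)) i ⟨j, hj⟩ (c ⟨j, hj⟩) (s ⟨j, hj⟩) :=
  hM.step ⟨j, hj⟩ hij

theorem IsRowSweep.apply_eq {n : ℕ} {i : Fin n} {M : ℕ → Matrix (Fin n) (Fin n) ℝ}
    {c s : Fin n → ℝ} (hM : IsRowSweep i M c s) {l m : Fin n} (hl : i ≠ l) (hm : i ≠ m)
    {k k' : ℕ} (hkk : k ≤ k') (hik : (i : ℕ) < k) (hk' : k' ≤ n)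
    (h : ∀ j, k ≤ j → j < k' → j ≠ l ∧ j ≠ m) : M k' l m = M k l m := by
  induction k', hkk using Nat.le_induction with
  | base => rfl
  | succ j hkj ih =>
    rw [← ih (by omega) fun x h1 h2 => h x h1 (by omega)]
    obtain ⟨h1, h2⟩ := h j hkj (by omega)
    exact (hM.step_nat (by omega) (by omega)).other l m hl.symm (fun e => h1 (by rw [e])) hm.symm
      (fun e => h2 (by rw [e]))

theorem IsRowSweep.abs_row_sub_le {n : ℕ} {i : Fin n} {M : ℕ → Matrix (Fin n) (Fin n) ℝ}
    {c s : Fin n → ℝ} (hM : IsRowSweep i M c s) {b : ℕ} (hib : (i : ℕ) < b) {S η : ℝ}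
    (hS0 : 0 ≤ S) (hη0 : 0 ≤ η)
    (hS : ∀ k ≤ n, ∀ a b, a ≠ b → |M k a b| ≤ S) (hη : ∀ k : Fin n, b ≤ k → |s k| ≤ η)
    {m : Fin n} (hm : i ≠ m) {k k' : ℕ} (hkk : k ≤ k') (hbk : b ≤ k) (hk' : k' ≤ n)
    (h : ∀ j, k ≤ j → j < k' → j ≠ m) : |M k' i m - M k i m| ≤ 2 * n * η * S := by
  have key : |M k' i m - M k i m| ≤ (k' - k : ℕ) * (2 * η * S) := by
    induction k', hkk using Nat.le_induction with
    | base => simp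
    | succ j hkj ih =>
      have ih := ih (by omega) fun x h1 h2 => h x h1 (by omega)
      have hs := hM.step_nat (j := j) (by omega) (by omega)
      have hjm : m ≠ ⟨j, by omega⟩ := fun e => h j hkj (by omega) (by rw [e])
      have h1 : M (j + 1) i m - M j i m =
          (c ⟨j, by omega⟩ - 1) * M j i m - s ⟨j, by omega⟩ * M j m ⟨j, by omega⟩ := by
        rw [← hs.symm.apply i m, hs.col_left m hm.symm hjm, (hM.symm j).apply i m]
        ring
      have h2 := hS j (by omega) i m hm
      have h3 := hS j (by omega) m ⟨j, by omega⟩ hjm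
      have h4 := hη ⟨j, by omega⟩ (by simp only []; omega)
      have h5 : |M (j + 1) i m - M j i m| ≤ 2 * η * S := by
        rw [h1]
        refine (abs_sub _ _).trans ?_
        rw [abs_mul, abs_mul]
        have := mul_le_mul (hs.one_sub_cos_le.trans h4) h2 (abs_nonneg _) hη0
        have := mul_le_mul h4 h3 (abs_nonneg _) hη0
        linarith
      have h6 : ((j + 1 - k : ℕ) : ℝ) = ((j - k : ℕ) : ℝ) + 1 := by
        rw [Nat.sub_add_comm hkj]; push_cast; ring
      rw [h6, add_mul, one_mul]
      calc |M (j + 1) i m - M k i m|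
          = |(M (j + 1) i m - M j i m) + (M j i m - M k i m)| := by ring_nf
        _ ≤ _ := (abs_add_le _ _).trans (by linarith)
  have h4 : ((k' - k : ℕ) : ℝ) ≤ n := by exact_mod_cast (by omega : k' - k ≤ n)
  calc _ ≤ ((k' - k : ℕ) : ℝ) * (2 * η * S) := key
    _ ≤ n * (2 * η * S) := by gcongr
    _ = _ := by ring

theorem IsRowSweep.abs_apply_le {n : ℕ} {i : Fin n} {M : ℕ → Matrix (Fin n) (Fin n) ℝ}
    {c s : Fin n → ℝ} (hM : IsRowSweep i M c s) {b : ℕ} (hib : (i : ℕ) < b) {S d : ℝ}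
    (hS0 : 0 ≤ S) (hd : 0 < d)
    (hS : ∀ k ≤ n, ∀ a b, a ≠ b → |M k a b| ≤ S) (hsin : ∀ k : Fin n, b ≤ k → |s k| ≤ |M k i k| / d)
    {l m : Fin n} (hbl : b ≤ l) (hlm : l < m) :
    |M n l m| ≤ |M b l m| + |M l i l| * |M m i m| / d + 4 * n * (S / d) ^ 2 * S := by
  have hη0 : 0 ≤ S / d := by positivity
  have hlm' : (l : ℕ) < m := hlm
  have hil : i < l := by rw [Fin.lt_def]; omega
  have him : i < m := by rw [Fin.lt_def]; omega
  have hη : ∀ k : Fin n, b ≤ k → |s k| ≤ S / d := fun k hk => (hsin k hk).trans (by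
    have := hS k k.2.le i k (fun e => by rw [← e] at hk; omega)
    gcongr)
  have hsl := hM.step l hil
  have hsm := hM.step m him
  have e1 : M l l m = M b l m :=
    hM.apply_eq hil.ne him.ne hbl hib l.2.le fun j h1 h2 => by omega
  have e2 : M (l + 1) l m = s l * M l i m + c l * M l l m := by
    rw [← hsl.symm.apply l m, hsl.col_right m him.ne' hlm.ne', (hM.symm l).apply i m,
      (hM.symm l).apply l m]
  have e3 : M m l m = M (l + 1) l m :=
    hM.apply_eq hil.ne him.ne (by omega) (by omega) m.2.le fun j h1 h2 => by omega
  have e4 : M (m + 1) l m = s m * M m i l + c m * M m l m := by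
    rw [hsm.col_right l hil.ne' hlm.ne, (hM.symm m).apply i l]
  have e5 : M n l m = M (m + 1) l m :=
    hM.apply_eq hil.ne him.ne (by omega) (by omega) le_rfl fun j h1 h2 => by omega
  have d1 : |M m i m - M l i m| ≤ 2 * n * (S / d) * S :=
    hM.abs_row_sub_le hib hS0 hη0 hS hη him.ne hlm'.le hbl m.2.le fun j h1 h2 => by omega
  have d2 : |M m i l - M (l + 1) i l| ≤ 2 * n * (S / d) * S :=
    hM.abs_row_sub_le hib hS0 hη0 hS hη hil.ne (by omega) (by omega) m.2.le
      fun j h1 h2 => by omega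
  rw [hsl.pivot, sub_zero] at d2
  have d3 : |M l i m| ≤ |M m i m| + 2 * n * (S / d) * S := by
    rw [abs_sub_comm] at d1
    have := abs_sub_abs_le_abs_sub (M l i m) (M m i m)
    linarith
  have f1 : |M (l + 1) l m| ≤ |s l| * |M l i m| + |M b l m| := by
    rw [e2, e1]
    refine (abs_add_le _ _).trans ?_
    rw [abs_mul, abs_mul]
    have := mul_le_of_le_one_left (abs_nonneg (M b l m)) hsl.abs_cos_le
    linarith
  have f2 : |M n l m| ≤ |s m| * |M m i l| + |M (l + 1) l m| := by
    rw [e5, e4, e3]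
    refine (abs_add_le _ _).trans ?_
    rw [abs_mul, abs_mul]
    have := mul_le_of_le_one_left (abs_nonneg (M (l + 1) l m)) hsm.abs_cos_le
    linarith
  have g1 : |s m| * |M m i l| ≤ (S / d) * (2 * n * (S / d) * S) :=
    mul_le_mul (hη m (by omega)) d2 (abs_nonneg _) hη0
  have g2 : |s l| * |M l i m| ≤ |M l i l| * |M m i m| / d + (S / d) * (2 * n * (S / d) * S) := by
    calc |s l| * |M l i m| ≤ |s l| * (|M m i m| + 2 * n * (S / d) * S) := by gcongr
      _ = |s l| * |M m i m| + |s l| * (2 * n * (S / d) * S) := by ring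
      _ ≤ (|M l i l| / d) * |M m i m| + (S / d) * (2 * n * (S / d) * S) := by
        gcongr
        · exact hsin l hbl
        · exact hη l hbl
      _ = _ := by ring
  linarith

/-- How much the eliminations outside the cluster of row `i` can increase the entries inside the
later clusters. -/
theorem IsRowSweep.sqrt_energy_inCluster_le {n : ℕ} {i : Fin n}
    {M : ℕ → Matrix (Fin n) (Fin n) ℝ} {c s : Fin n → ℝ} (hM : IsRowSweep i M c s)
    {cl : Fin n → ℝ} {b : ℕ} (hib : (i : ℕ) < b) (hbn : b ≤ n)
    (hcl : ∀ k, i < k → (cl k = cl i ↔ (k : ℕ) < b)) {S d : ℝ} (hS0 : 0 ≤ S) (hd : 0 < d)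
    (hS : ∀ k ≤ n, ∀ a b, a ≠ b → |M k a b| ≤ S)
    (hsin : ∀ k : Fin n, b ≤ k → |s k| ≤ |M k i k| / d) :
    Real.sqrt (energy (InCluster cl (i + 1)) (M n)) ≤
      Real.sqrt (energy (InCluster cl (i + 1)) (M b)) +
        ((∑ k ∈ Finset.Ioi i, M k i k ^ 2) / d + n * (4 * n * (S / d) ^ 2 * S)) := by
  classical
  set ε := 4 * n * (S / d) ^ 2 * S with hε
  have hε0 : 0 ≤ ε := by positivity
  set t : Fin n → ℝ := fun k => if i < k then |M k i k| else 0 with ht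
  have ht0 : ∀ k, 0 ≤ t k := fun k => by simp only [ht]; split_ifs <;> positivity
  have htsum : ∑ k, t k ^ 2 = ∑ k ∈ Finset.Ioi i, M k i k ^ 2 := by
    rw [← sum_ite_lt_eq_sum_Ioi]
    refine Finset.sum_congr rfl fun k _ => ?_
    simp only [ht]
    split_ifs <;> simp
  have hlt : ∀ l m : Fin n, i < l → l < m → cl l = cl m →
      |M n l m| ≤ |M b l m| + (t l * t m / d + ε) := by
    intro l m hil hlm h
    have him := hil.trans hlm
    by_cases hl : (l : ℕ) < b
    · have hm : (m : ℕ) < b := (hcl m him).mp (h ▸ (hcl l hil).mpr hl)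
      rw [hM.apply_eq (k := b) (k' := n) hil.ne him.ne hbn hib le_rfl fun j h1 h2 => by omega]
      have := ht0 l; have := ht0 m
      have : 0 ≤ t l * t m / d := by positivity
      linarith
    · have := hM.abs_apply_le hib hS0 hd hS hsin (by omega) hlm
      simp only [ht, hil, him, if_true]
      linarith
  have hle : ∀ l m : Fin n, InCluster cl (i + 1) l m →
      |M n l m| ≤ |M b l m| + (t l * t m / d + ε) := by
    rintro l m ⟨hne, h, h1, h2⟩
    rcases lt_or_gt_of_ne hne with hlm | hlm
    · exact hlt l m (by rw [Fin.lt_def]; omega) hlm h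
    · have := hlt m l (by rw [Fin.lt_def]; omega) hlm h.symm
      rwa [(hM.symm n).apply l m, (hM.symm b).apply l m, mul_comm (t m)] at this
  set P := InCluster cl (i + 1) with hP
  have henergy : ∀ T : Matrix (Fin n) (Fin n) ℝ,
      energy P T = ∑ x : Fin n × Fin n, (if P x.1 x.2 then |T x.1 x.2| else 0) ^ 2 := by
    intro T
    rw [Fintype.sum_prod_type]
    unfold energy
    refine Finset.sum_congr rfl fun a _ => Finset.sum_congr rfl fun b _ => ?_
    split_ifs <;> simp
  have hA : 0 ≤ ∑ k ∈ Finset.Ioi i, M k i k ^ 2 := Finset.sum_nonneg fun _ _ => sq_nonneg _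
  refine Real.sqrt_le_iff.mpr ⟨by positivity, ?_⟩
  calc energy P (M n) = ∑ x : Fin n × Fin n, (if P x.1 x.2 then |M n x.1 x.2| else 0) ^ 2 :=
        henergy _
    _ ≤ ∑ x : Fin n × Fin n, ((if P x.1 x.2 then |M b x.1 x.2| else 0) +
          (t x.1 * t x.2 / d + ε)) ^ 2 := by
      refine Finset.sum_le_sum fun x _ => ?_
      have h1 := ht0 x.1
      have h2 := ht0 x.2
      have h3 : 0 ≤ t x.1 * t x.2 / d := by positivity
      split_ifs with h
      · exact pow_le_pow_left₀ (abs_nonneg _) (hle _ _ h) 2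
      · rw [zero_pow two_ne_zero]; positivity
    _ ≤ _ := by
      refine sum_add_sq_le _ _ _ (Real.sqrt_nonneg _) (by positivity) ?_ ?_
      · rw [Real.sq_sqrt (energy_nonneg _ _), henergy]
      · refine sum_add_sq_le _ _ _ (by positivity) (by positivity) ?_ ?_
        · rw [Fintype.sum_prod_type, ← htsum, div_pow, sq (∑ k, t k ^ 2), Finset.sum_mul_sum,
            Finset.sum_div]
          refine Finset.sum_le_sum fun a _ => ?_
          rw [Finset.sum_div]
          exact Finset.sum_le_sum fun b _ => le_of_eq (by ring)
        · rw [Finset.sum_const, Finset.card_univ, Fintype.card_prod, Fintype.card_fin]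
          simp only [nsmul_eq_mul, Nat.cast_mul]
          exact le_of_eq (by ring)

/-! ### The whole sweep -/

/-- `G i k` is the matrix before the pivot `(i, k)` of the sweep. -/
structure IsSweep {n : ℕ} (G : ℕ → ℕ → Matrix (Fin n) (Fin n) ℝ) (c s : Fin n → Fin n → ℝ) :
    Prop where
  row : ∀ i : Fin n, IsRowSweep i (G i) (c i) (s i)
  next : ∀ i : Fin n, G (i + 1) 0 = G i n

theorem IsRowSweep.energy_inBox_zero_le {n : ℕ} {i : Fin n} {M : ℕ → Matrix (Fin n) (Fin n) ℝ}
    {c s : Fin n → ℝ} (hM : IsRowSweep i M c s) {k : ℕ} (hk : k ≤ n) :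
    energy (InBox 0 n) (M k) ≤ energy (InBox 0 n) (M 0) := by
  induction k with
  | zero => exact le_rfl
  | succ k ih =>
    refine le_trans ?_ (ih (by omega))
    by_cases hik : (i : ℕ) < k
    · have hne : i ≠ ⟨k, by omega⟩ := ne_of_lt hik
      rw [(hM.step_nat (by omega) hik).energy_eq (hM.symm k) hne (InBox.symm_iff 0 n)
        (by simp [InBox]) (by simp [InBox])]
      · nlinarith [sq_nonneg (M k i ⟨k, by omega⟩)]
      · intro a h1 h2
        simp only [InBox, ne_eq, h1, h2, not_false_eq_true, true_and]
        omega
      · exact ⟨hne, by omega, by simp only []; omega⟩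
    · exact le_of_eq (by rw [show M (k + 1) = M k from hM.skip ⟨k, by omega⟩ (by
        rw [Fin.le_def]; simp only []; omega)])

theorem IsRowSweep.abs_apply_le_sqrt {n : ℕ} {i : Fin n} {M : ℕ → Matrix (Fin n) (Fin n) ℝ}
    {c s : Fin n → ℝ} (hM : IsRowSweep i M c s) {S : ℝ} (hS0 : 0 ≤ S)
    (hS : energy (InBox 0 n) (M 0) ≤ S ^ 2) {k : ℕ} (hk : k ≤ n) {a b : Fin n} (hab : a ≠ b) :
    |M k a b| ≤ S := by
  refine abs_le_of_sq_le_sq ?_ hS0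
  refine le_trans (sq_le_energy _ ?_) ((hM.energy_inBox_zero_le hk).trans hS)
  exact ⟨hab, by omega, by omega⟩

theorem IsRowSweep.abs_diag_sub_le {n : ℕ} {i : Fin n} {M : ℕ → Matrix (Fin n) (Fin n) ℝ}
    {c s : Fin n → ℝ} (hM : IsRowSweep i M c s) {S : ℝ} (hS0 : 0 ≤ S)
    (hS : energy (InBox 0 n) (M 0) ≤ S ^ 2) {k : ℕ} (hk : k ≤ n) (a : Fin n) :
    |M k a a - M 0 a a| ≤ k * S := by
  induction k with
  | zero => simp
  | succ k ih =>
    have ih := ih (by omega)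
    have h1 : |M (k + 1) a a - M k a a| ≤ S := by
      by_cases hik : (i : ℕ) < k
      · have hne : i ≠ ⟨k, by omega⟩ := ne_of_lt hik
        have hs := hM.step_nat (j := k) (by omega) hik
        have hle := hM.abs_apply_le_sqrt hS0 hS (k := k) (by omega) hne
        by_cases h1 : a = i
        · rw [h1]; exact hs.diag_left.trans hle
        · by_cases h2 : a = ⟨k, by omega⟩
          · rw [h2]; exact hs.diag_right.trans hle
          · rw [hs.other a a h1 h2 h1 h2, sub_self, abs_zero]; exact hS0
      · rw [show M (k + 1) = M k from hM.skip ⟨k, by omega⟩ (by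
          rw [Fin.le_def]; simp only []; omega), sub_self, abs_zero]
        exact hS0
    have h2 := abs_sub_le (M (k + 1) a a) (M k a a) (M 0 a a)
    push_cast
    linarith

/-- The indices to the right of `i` in the cluster of `i` are the ones left of some bound. -/
theorem exists_cluster_bound {n : ℕ} {cl : Fin n → ℝ}
    (hcl : ∀ i m k : Fin n, i < m → m < k → cl k = cl i → cl m = cl i) (i : Fin n) :
    ∃ b : ℕ, (i : ℕ) < b ∧ b ≤ n ∧ ∀ k, i < k → (cl k = cl i ↔ (k : ℕ) < b) := by
  classical
  by_cases h : ∃ j : ℕ, ∃ hj : j < n, (i : ℕ) < j ∧ cl ⟨j, hj⟩ ≠ cl i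
  · obtain ⟨h1, h2, h3⟩ := Nat.find_spec h
    refine ⟨Nat.find h, h2, h1.le, fun k hk => ⟨fun hk' => ?_, fun hk' => ?_⟩⟩
    · by_contra hlt
      rcases (not_lt.mp hlt).eq_or_lt with he | hl
      · exact h3 ((congrArg cl (Fin.ext he : (⟨Nat.find h, h1⟩ : Fin n) = k)).trans hk')
      · exact h3 (hcl i ⟨Nat.find h, h1⟩ k h2 hl hk')
    · have := Nat.find_min h hk'
      push Not at this
      exact this k.2 hk
  · push Not at h
    exact ⟨n, i.2, le_rfl, fun k hk => ⟨fun _ => k.2, fun _ => h k k.2 hk⟩⟩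

/-- The effect of one row of the sweep on the off-diagonal sums of squares, with `S` a bound for
the off-diagonal Frobenius norm, `d` for the gaps between the clusters and `x` the norm of the part
of the row inside its cluster before the pivots outside the cluster are visited. -/
theorem IsRowSweep.row_bounds {n : ℕ} {i : Fin n} {M : ℕ → Matrix (Fin n) (Fin n) ℝ}
    {c s : Fin n → ℝ} (hM : IsRowSweep i M c s) {cl : Fin n → ℝ}
    (hcl : ∀ i m k : Fin n, i < m → m < k → cl k = cl i → cl m = cl i)
    {S d : ℝ} (hS0 : 0 ≤ S) (hd : 0 < d) (hS : energy (InBox 0 n) (M 0) ≤ S ^ 2)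
    (hgap : ∀ a b, cl a ≠ cl b → d + 2 * n * S ≤ |M 0 a a - M 0 b b|) :
    ∃ a x g y r : ℝ, 0 ≤ a ∧ 0 ≤ x ∧ 0 ≤ g ∧ 0 ≤ y ∧ 0 ≤ r ∧
      a ≤ energy (InBox i n) (M 0) / 2 ∧
      energy (InBox 0 n) (M n) = energy (InBox 0 n) (M 0) - 2 * a ∧
      energy (InBox (i + 1) n) (M n) = energy (InBox i n) (M 0) - 2 * a - 2 * r ^ 2 ∧
      r ≤ x + g ∧
      g ^ 2 ≤ a * (energy (InBox i n) (M 0) / 2 - a) / d ^ 2 ∧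
      2 * x ^ 2 + y ^ 2 ≤ energy (InCluster cl i) (M 0) ∧
      energy (InCluster cl (i + 1)) (M n) ≤
        (y + (a / d + n * (4 * n * (S / d) ^ 2 * S))) ^ 2 := by
  obtain ⟨b, hib, hbn, hb⟩ := exists_cluster_bound hcl i
  have hS' : ∀ k ≤ n, ∀ a b, a ≠ b → |M k a b| ≤ S := fun k hk a b hab =>
    hM.abs_apply_le_sqrt hS0 hS hk hab
  have hsin : ∀ k : Fin n, b ≤ k → |s k| ≤ |M k i k| / d := by
    intro k hk
    have hik : i < k := by rw [Fin.lt_def]; omega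
    have hne : cl k ≠ cl i := fun h => by have := (hb k hik).mp h; omega
    have hs := hM.step k hik
    have h1 := hgap k i hne
    have h2 := hM.abs_diag_sub_le hS0 hS k.2.le k
    have h3 := hM.abs_diag_sub_le hS0 hS k.2.le i
    have hkn : ((k : ℕ) : ℝ) ≤ n := by exact_mod_cast k.2.le
    have h4 : ((k : ℕ) : ℝ) * S ≤ n * S := by gcongr
    have h5 : d ≤ |M k k k - M k i i| := by
      have := abs_sub_le (M 0 k k) (M k k k) (M 0 i i)
      have := abs_sub_le (M k k k) (M k i i) (M 0 i i)
      rw [abs_sub_comm] at h2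
      linarith
    rw [le_div_iff₀ hd]
    exact (mul_le_mul_of_nonneg_left h5 (abs_nonneg _)).trans hs.sin_le
  set a := ∑ k ∈ Finset.Ioi i, M k i k ^ 2 with ha
  have ha0 : 0 ≤ a := Finset.sum_nonneg fun _ _ => sq_nonneg _
  have hcols := hM.sum_columns
  have hcols0 : 0 ≤ ∑ k ∈ Finset.Ioi i, ∑ m ∈ between i k, M k m k ^ 2 :=
    Finset.sum_nonneg fun _ _ => Finset.sum_nonneg fun _ _ => sq_nonneg _
  rw [hcols] at hcols0
  refine ⟨a, visitedNorm i M b, Real.sqrt (a * (energy (InBox i n) (M 0) / 2 - a)) / d,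
    Real.sqrt (energy (InCluster cl (i + 1)) (M b)), visitedNorm i M n, ha0,
    Real.sqrt_nonneg _, by positivity, Real.sqrt_nonneg _, Real.sqrt_nonneg _, by linarith,
    hM.energy_inBox (Nat.zero_le _), ?_, hM.visitedNorm_le hib hbn hd hsin, ?_, ?_, ?_⟩
  · have h1 := hM.energy_inBox le_rfl
    have h2 := energy_inBox_succ_left i (hM.symm n)
    rw [visitedNorm_sq, between_eq_Ioi]
    linarith
  · rw [div_pow, Real.sq_sqrt (mul_nonneg ha0 hcols0)]
  · rw [Real.sq_sqrt (energy_nonneg _ _)]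
    have h1 := energy_inCluster_eq_add (hM.symm b) hb
    have h2 := hM.energy_inCluster hbn hb
    linarith
  · have h := hM.sqrt_energy_inCluster_le hib hbn hb hS0 hd hS' hsin
    have h2 := pow_le_pow_left₀ (Real.sqrt_nonneg _) h 2
    rwa [Real.sq_sqrt (energy_nonneg _ _)] at h2

theorem add_sq_add_le_sqrt_add_sqrt_sq (X Γ x g : ℝ) :
    (X + Γ) ^ 2 + 2 * (x + g) ^ 2 ≤
      (Real.sqrt (X ^ 2 + 2 * x ^ 2) + Real.sqrt (Γ ^ 2 + 2 * g ^ 2)) ^ 2 := by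
  have h1 : Real.sqrt (X ^ 2 + 2 * x ^ 2) ^ 2 = X ^ 2 + 2 * x ^ 2 := Real.sq_sqrt (by positivity)
  have h2 : Real.sqrt (Γ ^ 2 + 2 * g ^ 2) ^ 2 = Γ ^ 2 + 2 * g ^ 2 := Real.sq_sqrt (by positivity)
  have h3 : X * Γ + 2 * (x * g) ≤
      Real.sqrt (X ^ 2 + 2 * x ^ 2) * Real.sqrt (Γ ^ 2 + 2 * g ^ 2) := by
    refine le_of_sq_le_sq ?_ (by positivity)
    rw [mul_pow, h1, h2]
    nlinarith [sq_nonneg (X * g - x * Γ)]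
  nlinarith

theorem IsSweep.energy_inBox_zero_le {n : ℕ} {G : ℕ → ℕ → Matrix (Fin n) (Fin n) ℝ}
    {c s : Fin n → Fin n → ℝ} (hG : IsSweep G c s) {i : ℕ} (hi : i ≤ n) :
    energy (InBox 0 n) (G i 0) ≤ energy (InBox 0 n) (G 0 0) := by
  induction i with
  | zero => exact le_rfl
  | succ i ih =>
    have h := hG.next ⟨i, by omega⟩
    simp only [] at h
    rw [h]
    exact ((hG.row ⟨i, by omega⟩).energy_inBox_zero_le le_rfl).trans (ih (by omega))

theorem IsSweep.abs_diag_sub_le {n : ℕ} {G : ℕ → ℕ → Matrix (Fin n) (Fin n) ℝ}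
    {c s : Fin n → Fin n → ℝ} (hG : IsSweep G c s) {S : ℝ} (hS0 : 0 ≤ S)
    (hS : energy (InBox 0 n) (G 0 0) ≤ S ^ 2) {i : ℕ} (hi : i ≤ n) (a : Fin n) :
    |G i 0 a a - G 0 0 a a| ≤ i * (n * S) := by
  induction i with
  | zero => simp
  | succ i ih =>
    have h := hG.next ⟨i, by omega⟩
    simp only [] at h
    have h1 := (hG.row ⟨i, by omega⟩).abs_diag_sub_le hS0
      ((hG.energy_inBox_zero_le (by simp only []; omega)).trans hS) le_rfl a
    have h2 := ih (by omega)
    have h3 := abs_sub_le (G i n a a) (G i 0 a a) (G 0 0 a a)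
    simp only [] at h1
    rw [h]
    push_cast
    linarith

/-- A sweep reduces the off-diagonal Frobenius norm quadratically. -/
theorem IsSweep.energy_le {n : ℕ} {G : ℕ → ℕ → Matrix (Fin n) (Fin n) ℝ}
    {c s : Fin n → Fin n → ℝ} (hG : IsSweep G c s) {cl : Fin n → ℝ}
    (hcl : ∀ i m k : Fin n, i < m → m < k → cl k = cl i → cl m = cl i)
    {S d q : ℝ} (hS0 : 0 ≤ S) (hd : 0 < d) (hq : 0 ≤ q)
    (hS : energy (InBox 0 n) (G 0 0) = S ^ 2)
    (hq2 : energy (InCluster cl 0) (G 0 0) ≤ q ^ 2)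
    (hgap : ∀ a b, cl a ≠ cl b →
      d + 2 * (n + 1) * n * S ≤ |G 0 0 a a - G 0 0 b b|) :
    energy (InBox 0 n) (G n 0) ≤
      (q + S ^ 2 / d + n * (n * (4 * n * (S / d) ^ 2 * S))) ^ 2 := by
  set ε := (n : ℝ) * (4 * n * (S / d) ^ 2 * S) with hε
  have hε0 : 0 ≤ ε := by positivity
  have key : ∀ i : ℕ, i ≤ n → ∃ X Γ : ℝ, 0 ≤ X ∧ 0 ≤ Γ ∧
      energy (InBox i n) (G i 0) ≤ S ^ 2 ∧
      energy (InBox 0 n) (G i 0) - energy (InBox i n) (G i 0) ≤ (X + Γ) ^ 2 ∧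
      X ^ 2 + energy (InCluster cl i) (G i 0) ≤
        (q + (S ^ 2 / 2 - energy (InBox i n) (G i 0) / 2) / d + i * ε) ^ 2 ∧
      Γ ^ 2 ≤ ((S ^ 2 / 2) ^ 2 - (energy (InBox i n) (G i 0) / 2) ^ 2) / d ^ 2 := by
    intro i
    induction i with
    | zero =>
      intro _
      refine ⟨0, 0, le_rfl, le_rfl, hS.le, by simp, ?_, by rw [hS]; simp⟩
      rw [hS]; simpa using hq2
    | succ i ih =>
      intro hi
      obtain ⟨X, Γ, hX, hΓ, h0, h1, h2, h3⟩ := ih (by omega)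
      have hnext := hG.next ⟨i, by omega⟩
      simp only [] at hnext
      have hni : ((i : ℕ) : ℝ) ≤ n := by exact_mod_cast (by omega : i ≤ n)
      have hgap' : ∀ a b, cl a ≠ cl b → d + 2 * n * S ≤ |G i 0 a a - G i 0 b b| := by
        intro a b hab
        have e1 := hgap a b hab
        have e2 := hG.abs_diag_sub_le hS0 hS.le (i := i) (by omega) a
        have e3 := hG.abs_diag_sub_le hS0 hS.le (i := i) (by omega) b
        have e4 : (i : ℝ) * (n * S) ≤ n * (n * S) := by gcongr
        have := abs_sub_le (G 0 0 a a) (G i 0 a a) (G 0 0 b b)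
        have := abs_sub_le (G i 0 a a) (G i 0 b b) (G 0 0 b b)
        rw [abs_sub_comm] at e2
        have e5 : 2 * (n + 1) * n * S = 2 * n * S + 2 * (n * (n * S)) := by ring
        linarith
      obtain ⟨a, x, g, y, r, ha, hx, hg, hy, hr, f1, f2, f3, f4, f5, f6, f7⟩ :=
        (hG.row ⟨i, by omega⟩).row_bounds hcl hS0 hd
          ((hG.energy_inBox_zero_le (by simp only []; omega)).trans hS.le) hgap'
      simp only [] at f1 f2 f3 f4 f5 f6 f7
      rw [hnext]
      have hh := energy_nonneg (InBox (n := n) (i + 1) n) (G i n)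
      set h := energy (InBox i n) (G i 0) with hh_def
      refine ⟨Real.sqrt (X ^ 2 + 2 * x ^ 2), Real.sqrt (Γ ^ 2 + 2 * g ^ 2), Real.sqrt_nonneg _,
        Real.sqrt_nonneg _, ?_, ?_, ?_, ?_⟩
      · rw [f3]; linarith [sq_nonneg r]
      · refine le_trans ?_ (add_sq_add_le_sqrt_add_sqrt_sq X Γ x g)
        rw [f2, f3]
        have := pow_le_pow_left₀ hr f4 2
        linarith
      · rw [Real.sq_sqrt (by positivity), f3]
        set K := q + (S ^ 2 / 2 - h / 2) / d + i * ε with hK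
        have hK0 : 0 ≤ K := by
          have : 0 ≤ (S ^ 2 / 2 - h / 2) / d := div_nonneg (by linarith) hd.le
          positivity
        have hyK : y ≤ K := by
          refine le_of_sq_le_sq ?_ hK0
          linarith [sq_nonneg x, sq_nonneg X]
        have hδ : 0 ≤ a / d + ε := by positivity
        calc _ ≤ X ^ 2 + 2 * x ^ 2 + (y + (a / d + ε)) ^ 2 := by
              linarith
          _ ≤ (K + (a / d + ε)) ^ 2 := by
            have e1 := mul_le_mul_of_nonneg_right hyK hδ
            have e2 : (y + (a / d + ε)) ^ 2 =
              y ^ 2 + 2 * (y * (a / d + ε)) + (a / d + ε) ^ 2 := by ring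
            have e3 : (K + (a / d + ε)) ^ 2 =
              K ^ 2 + 2 * (K * (a / d + ε)) + (a / d + ε) ^ 2 := by ring
            linarith
          _ ≤ _ := by
            refine pow_le_pow_left₀ (by positivity) ?_ 2
            have : a / d ≤ (a + r ^ 2) / d := by gcongr; linarith [sq_nonneg r]
            have e : (S ^ 2 / 2 - (h - 2 * a - 2 * r ^ 2) / 2) / d =
                (S ^ 2 / 2 - h / 2) / d + (a + r ^ 2) / d := by ring
            rw [e]
            push_cast
            linarith
      · rw [Real.sq_sqrt (by positivity), f3]
        rw [f3] at hh
        have e1 : Γ ^ 2 + 2 * g ^ 2 ≤ ((S ^ 2 / 2) ^ 2 - (h / 2) ^ 2 + 2 * (a * (h / 2 - a))) / d ^ 2 := by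
          rw [add_div, mul_div_assoc]; linarith
        refine e1.trans (div_le_div_of_nonneg_right ?_ (by positivity))
        have e2 := pow_le_pow_left₀ (by linarith : 0 ≤ (h - 2 * a - 2 * r ^ 2) / 2)
          (by linarith [sq_nonneg r] : (h - 2 * a - 2 * r ^ 2) / 2 ≤ h / 2 - a) 2
        have e3 : (h / 2 - a) ^ 2 + a ^ 2 = (h / 2) ^ 2 - 2 * (a * (h / 2 - a)) := by ring
        linarith [sq_nonneg a]
  obtain ⟨X, Γ, hX, hΓ, h0, h1, h2, h3⟩ := key n le_rfl
  have hn0 : energy (InBox n n) (G n 0) = 0 := energy_inBox_empty (by omega) _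
  rw [hn0] at h1 h2 h3
  have g1 : X ≤ q + (S ^ 2 / 2) / d + n * ε := by
    refine le_of_sq_le_sq ?_ (by positivity)
    have := energy_nonneg (InCluster cl n) (G n 0)
    simp only [zero_div, sub_zero] at h2
    linarith
  have g2 : Γ ≤ (S ^ 2 / 2) / d := by
    refine le_of_sq_le_sq ?_ (by positivity)
    rw [div_pow]
    simpa using h3
  calc _ ≤ (X + Γ) ^ 2 := by linarith
    _ ≤ _ := by
      refine pow_le_pow_left₀ (by positivity) ?_ 2
      have : S ^ 2 / d = (S ^ 2 / 2) / d + (S ^ 2 / 2) / d := by ring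
      linarith

/-! ### The sweep of the algorithm -/

/-- Row `i` of a sweep up to the pivot `(i, k)`, started at `S`. -/
def rowIterate {n : ℕ} (ν : ℝ) (i : Fin n) (S : Matrix (Fin n) (Fin n) ℝ) (k : ℕ) :
    Matrix (Fin n) (Fin n) ℝ :=
  ((List.finRange n).take k).foldl (fun S k => if i < k then jacobiUpdate ν S i k else S) S

/-- The matrix at the beginning of row `i` of a sweep started at `T`. -/
def rowStart {n : ℕ} (ν : ℝ) (T : Matrix (Fin n) (Fin n) ℝ) (i : ℕ) :
    Matrix (Fin n) (Fin n) ℝ :=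
  ((List.finRange n).take i).foldl (fun S i => rowIterate ν i S n) T

theorem foldl_take_finRange_succ {α : Type*} {n : ℕ} (f : α → Fin n → α) (x : α) (k : Fin n) :
    ((List.finRange n).take (k + 1)).foldl f x =
      f (((List.finRange n).take k).foldl f x) k := by
  rw [List.take_add_one, List.foldl_append]
  simp

theorem length_rowCyclicPairs (n : ℕ) : (rowCyclicPairs n).length = n * (n - 1) / 2 := by
  have h : ∀ i : Fin n, (((List.finRange n).filter fun j => i < j).map fun j => (i, j)).length =
      n - 1 - i := by
    intro i
    rw [List.length_map, ← Fin.card_Ioi i]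
    have : Finset.Ioi i = ((List.finRange n).filter fun j => i < j).toFinset := by
      ext; simp
    rw [this, List.toFinset_card_of_nodup ((List.nodup_finRange n).filter _)]
  rw [rowCyclicPairs, List.length_flatMap]
  simp only [h]
  rw [← Fin.sum_univ_def, Fin.sum_univ_eq_sum_range (fun i => n - 1 - i),
    Finset.sum_range_reflect (fun i => i), Finset.sum_range_id]

theorem jacobiIterate_eq_rowStart {n : ℕ} (ν : ℝ) (T : Matrix (Fin n) (Fin n) ℝ) :
    jacobiIterate ν T (n * (n - 1) / 2) = rowStart ν T n := by
  rw [jacobiIterate, ← length_rowCyclicPairs, List.take_length, rowCyclicPairs,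
    List.foldl_flatMap, rowStart, List.take_of_length_le (by simp)]
  congr 1
  ext S i : 2
  rw [rowIterate, List.take_of_length_le (by simp), List.foldl_map, List.foldl_filter]
  simp

theorem rowIterate_isSymm {n : ℕ} (ν : ℝ) (i : Fin n) {S : Matrix (Fin n) (Fin n) ℝ}
    (hS : S.IsSymm) (k : ℕ) : (rowIterate ν i S k).IsSymm := by
  unfold rowIterate
  generalize (List.finRange n).take k = l
  induction l generalizing S with
  | nil => exact hS
  | cons k l ih =>
    refine ih ?_
    beta_reduce
    split_ifs with h
    · obtain ⟨c, s, hs⟩ := exists_isJacobiStep_jacobiUpdate ν hS h.ne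
      exact hs.symm
    · exact hS

theorem rowStart_isSymm {n : ℕ} (ν : ℝ) {T : Matrix (Fin n) (Fin n) ℝ} (hT : T.IsSymm) (i : ℕ) :
    (rowStart ν T i).IsSymm := by
  unfold rowStart
  generalize (List.finRange n).take i = l
  induction l generalizing T with
  | nil => exact hT
  | cons k l ih => exact ih (rowIterate_isSymm ν k hT n)

theorem exists_isRowSweep {n : ℕ} (ν : ℝ) (i : Fin n) {S : Matrix (Fin n) (Fin n) ℝ}
    (hS : S.IsSymm) : ∃ c s, IsRowSweep i (rowIterate ν i S) c s := by
  have h : ∀ k : Fin n, ∃ c s, i < k →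
      IsJacobiStep (rowIterate ν i S k) (rowIterate ν i S (k + 1)) i k c s := by
    intro k
    by_cases hk : i < k
    · obtain ⟨c, s, hs⟩ :=
        exists_isJacobiStep_jacobiUpdate ν (rowIterate_isSymm ν i hS k) hk.ne
      refine ⟨c, s, fun _ => ?_⟩
      have : rowIterate ν i S (k + 1) = jacobiUpdate ν (rowIterate ν i S k) i k := by
        rw [rowIterate, foldl_take_finRange_succ, if_pos hk]; rfl
      rwa [this]
    · exact ⟨0, 0, fun h => absurd h hk⟩
  choose c s hcs using h
  refine ⟨c, s, rowIterate_isSymm ν i hS, fun k hk => ?_, hcs⟩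
  rw [rowIterate, foldl_take_finRange_succ, if_neg (not_lt.mpr hk)]; rfl

theorem exists_isSweep {n : ℕ} (ν : ℝ) {T : Matrix (Fin n) (Fin n) ℝ} (hT : T.IsSymm) :
    ∃ G c s, IsSweep (n := n) G c s ∧ G 0 0 = T ∧
      G n 0 = jacobiIterate ν T (n * (n - 1) / 2) := by
  have h := fun i : Fin n => exists_isRowSweep ν i (rowStart_isSymm ν hT i)
  choose c s hcs using h
  refine ⟨fun i k => if h : i < n then rowIterate ν ⟨i, h⟩ (rowStart ν T i) k else rowStart ν T i,
    c, s, ⟨fun i => ?_, fun i => ?_⟩, ?_, ?_⟩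
  · simpa using hcs i
  · have h1 : rowStart ν T (i + 1) = rowIterate ν i (rowStart ν T i) n := by
      rw [rowStart, foldl_take_finRange_succ]; rfl
    simp only [i.2, dif_pos, Fin.eta]
    rw [← h1]
    split_ifs <;> simp [rowIterate]
  · by_cases h : 0 < n <;> simp [h, rowIterate, rowStart]
  · simp [jacobiIterate_eq_rowStart]

/-! ### The entries inside the clusters of the initial matrix -/

theorem exists_spectral_decomposition {n : ℕ} {T : Matrix (Fin n) (Fin n) ℝ} (hT : T.IsSymm) :
    ∃ (U : Matrix (Fin n) (Fin n) ℝ) (Λ : Fin n → ℝ), (∀ j, Λ j ∈ spectrum ℝ T) ∧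
      (∀ a b, ∑ j, U a j * U b j = if a = b then 1 else 0) ∧
      (∀ a b, T a b = ∑ j, U a j * Λ j * U b j) ∧
      ∀ a b, ∑ m, T a m * T b m = ∑ j, U a j * Λ j ^ 2 * U b j := by
  have hH : T.IsHermitian := by
    unfold Matrix.IsHermitian
    rw [Matrix.conjTranspose_eq_transpose_of_trivial, hT.eq]
  set U : Matrix (Fin n) (Fin n) ℝ := hH.eigenvectorUnitary.1 with hU
  have hU1 : U * Uᵀ = 1 := by
    have := Unitary.coe_mul_star_self hH.eigenvectorUnitary
    rwa [Unitary.coe_star, ← hU, Matrix.star_eq_conjTranspose, Matrix.conjTranspose_eq_transpose_of_trivial] at this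
  have hU2 : Uᵀ * U = 1 := mul_eq_one_comm.mp hU1
  have hspec : T = U * diagonal hH.eigenvalues * Uᵀ := by
    have := hH.spectral_theorem
    rw [Unitary.conjStarAlgAut_apply, ← hU, Matrix.star_eq_conjTranspose,
      Matrix.conjTranspose_eq_transpose_of_trivial] at this
    simpa using this
  have hentry : ∀ (f : Fin n → ℝ) (a b : Fin n),
      (U * diagonal f * Uᵀ) a b = ∑ j, U a j * f j * U b j := by
    intro f a b
    rw [Matrix.mul_apply]
    simp only [Matrix.mul_diagonal, Matrix.transpose_apply]
  refine ⟨U, hH.eigenvalues, hH.eigenvalues_mem_spectrum_real, fun a b => ?_, fun a b => ?_,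
    fun a b => ?_⟩
  · have := congrFun (congrFun hU1 a) b
    simpa [Matrix.mul_apply, Matrix.one_apply] using this
  · rw [← hentry, ← hspec]
  · have h2 : T * Tᵀ = U * diagonal (fun j => hH.eigenvalues j ^ 2) * Uᵀ := by
      rw [hT.eq]
      nth_rewrite 1 [hspec]
      nth_rewrite 2 [hspec]
      calc _ = U * diagonal hH.eigenvalues * (Uᵀ * U) * diagonal hH.eigenvalues * Uᵀ := by
            simp only [Matrix.mul_assoc]
        _ = _ := by
          rw [hU2, Matrix.mul_one, Matrix.mul_assoc U, Matrix.diagonal_mul_diagonal]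
          simp only [sq]
    rw [← hentry, ← h2, Matrix.mul_apply]
    rfl

/-- The sum of the squares of the off-diagonal entries in row `a`. -/
def offRow {n : ℕ} (T : Matrix (Fin n) (Fin n) ℝ) (a : Fin n) : ℝ :=
  ∑ m ∈ Finset.univ.erase a, T a m ^ 2

theorem offRow_nonneg {n : ℕ} (T : Matrix (Fin n) (Fin n) ℝ) (a : Fin n) : 0 ≤ offRow T a :=
  Finset.sum_nonneg fun _ _ => sq_nonneg _

theorem sum_offRow {n : ℕ} (T : Matrix (Fin n) (Fin n) ℝ) :
    ∑ a, offRow T a = energy (InBox 0 n) T := by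
  classical
  unfold offRow energy
  refine Finset.sum_congr rfl fun a _ => ?_
  rw [← Finset.sum_filter]
  refine Finset.sum_congr ?_ fun _ _ => rfl
  ext b
  simp [InBox, eq_comm]

theorem sum_eigenvector_residual {n : ℕ} {T U : Matrix (Fin n) (Fin n) ℝ} {Λ : Fin n → ℝ}
    (h1 : ∀ a b, ∑ j, U a j * U b j = if a = b then 1 else 0)
    (h2 : ∀ a b, T a b = ∑ j, U a j * Λ j * U b j)
    (h3 : ∀ a b, ∑ m, T a m * T b m = ∑ j, U a j * Λ j ^ 2 * U b j) (a : Fin n) :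
    ∑ j, (U a j * (Λ j - T a a)) ^ 2 = offRow T a := by
  have e1 : ∑ j, (U a j * (Λ j - T a a)) ^ 2 = ∑ j, U a j * Λ j ^ 2 * U a j -
      2 * T a a * ∑ j, U a j * Λ j * U a j + T a a ^ 2 * ∑ j, U a j * U a j := by
    rw [Finset.mul_sum, Finset.mul_sum, ← Finset.sum_sub_distrib, ← Finset.sum_add_distrib]
    exact Finset.sum_congr rfl fun j _ => by ring
  rw [e1, ← h2, ← h3, h1, if_pos rfl, offRow,
    ← Finset.add_sum_erase Finset.univ (fun m => T a m * T a m) (Finset.mem_univ a)]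
  simp only [← sq]
  ring

theorem sq_apply_le_offRow_mul {n : ℕ} {T U : Matrix (Fin n) (Fin n) ℝ} {Λ : Fin n → ℝ}
    (h1 : ∀ a b, ∑ j, U a j * U b j = if a = b then 1 else 0)
    (h2 : ∀ a b, T a b = ∑ j, U a j * Λ j * U b j)
    (h3 : ∀ a b, ∑ m, T a m * T b m = ∑ j, U a j * Λ j ^ 2 * U b j)
    {S d l : ℝ} (hd : 0 < d) (hSd : 0 < d - S) (hS0 : 0 ≤ S)
    (hgap : ∀ j, Λ j ≠ l → d ≤ |Λ j - l|) {a b : Fin n} (hab : a ≠ b)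
    (ha : |T a a - l| ≤ S) (hb : |T b b - l| ≤ S) :
    T a b ^ 2 ≤ offRow T a * offRow T b / ((d - S) ^ 2 / d) ^ 2 := by
  have e1 : T a b = ∑ j, U a j * (Λ j - l) * U b j := by
    have : ∑ j, U a j * (Λ j - l) * U b j = ∑ j, U a j * Λ j * U b j - l * ∑ j, U a j * U b j := by
      rw [Finset.mul_sum, ← Finset.sum_sub_distrib]
      exact Finset.sum_congr rfl fun j _ => by ring
    rw [this, h1, if_neg hab, h2]; ring
  have hres : ∀ (c : Fin n) (j : Fin n), |T c c - l| ≤ S → Λ j ≠ l →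
      (d - S) / d * |Λ j - l| ≤ |Λ j - T c c| := by
    intro c j hc hj
    have g := hgap j hj
    have t := abs_sub_le (Λ j) (T c c) l
    rw [div_mul_eq_mul_div, div_le_iff₀ hd]
    nlinarith [mul_le_mul_of_nonneg_left g hS0]
  have hterm : ∀ j, |U a j * (Λ j - l) * U b j| * ((d - S) ^ 2 / d) ≤
      |U a j * (Λ j - T a a)| * |U b j * (Λ j - T b b)| := by
    intro j
    by_cases hj : Λ j = l
    · simp only [hj, sub_self, mul_zero, zero_mul, abs_zero]
      positivity
    · have r1 := hres a j ha hj
      have r2 := hres b j hb hj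
      have g := hgap j hj
      have p : 0 ≤ (d - S) / d * |Λ j - l| := by positivity
      have r3 : |Λ j - l| * ((d - S) ^ 2 / d) ≤ |Λ j - T a a| * |Λ j - T b b| := by
        refine le_trans ?_ (mul_le_mul r1 r2 p (abs_nonneg _))
        have : (d - S) / d * |Λ j - l| * ((d - S) / d * |Λ j - l|) =
            |Λ j - l| * ((d - S) ^ 2 / d) * (|Λ j - l| / d) := by field_simp
        rw [this]
        refine le_mul_of_one_le_right (by positivity) ?_
        rwa [one_le_div hd]
      rw [abs_mul, abs_mul, abs_mul, abs_mul]
      calc _ = (|U a j| * |U b j|) * (|Λ j - l| * ((d - S) ^ 2 / d)) := by ring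
        _ ≤ (|U a j| * |U b j|) * (|Λ j - T a a| * |Λ j - T b b|) := by gcongr
        _ = _ := by ring
  have hsum : |T a b| * ((d - S) ^ 2 / d) ≤
      ∑ j, |U a j * (Λ j - T a a)| * |U b j * (Λ j - T b b)| := by
    calc _ ≤ (∑ j, |U a j * (Λ j - l) * U b j|) * ((d - S) ^ 2 / d) := by
          rw [e1]; gcongr; exact Finset.abs_sum_le_sum_abs _ _
      _ ≤ _ := by rw [Finset.sum_mul]; exact Finset.sum_le_sum fun j _ => hterm j
  rw [le_div_iff₀ (by positivity)]
  calc T a b ^ 2 * ((d - S) ^ 2 / d) ^ 2 = (|T a b| * ((d - S) ^ 2 / d)) ^ 2 := by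
        rw [mul_pow, sq_abs]
    _ ≤ (∑ j, |U a j * (Λ j - T a a)| * |U b j * (Λ j - T b b)|) ^ 2 :=
      pow_le_pow_left₀ (by positivity) hsum 2
    _ ≤ _ := Finset.sum_mul_sq_le_sq_mul_sq _ _ _
    _ = _ := by
      simp only [sq_abs]
      rw [sum_eigenvector_residual h1 h2 h3, sum_eigenvector_residual h1 h2 h3]

theorem exists_eigenvalue_near_diag {n : ℕ} {T U : Matrix (Fin n) (Fin n) ℝ} {Λ : Fin n → ℝ}
    (h1 : ∀ a b, ∑ j, U a j * U b j = if a = b then 1 else 0)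
    (h2 : ∀ a b, T a b = ∑ j, U a j * Λ j * U b j)
    (h3 : ∀ a b, ∑ m, T a m * T b m = ∑ j, U a j * Λ j ^ 2 * U b j) {S : ℝ} (hS0 : 0 ≤ S)
    (hS : energy (InBox 0 n) T ≤ S ^ 2) (a : Fin n) : ∃ j, |T a a - Λ j| ≤ S := by
  by_contra! hcon
  have h4 := sum_eigenvector_residual h1 h2 h3 a
  have h5 : offRow T a ≤ S ^ 2 := by
    rw [← sum_offRow] at hS
    exact (Finset.single_le_sum (fun a _ => offRow_nonneg T a) (Finset.mem_univ a)).trans hS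
  have h6 : ∑ j, U a j ^ 2 = 1 := by simpa [sq] using h1 a a
  obtain ⟨j, -, hj⟩ : ∃ j ∈ Finset.univ, U a j ^ 2 ≠ 0 :=
    Finset.exists_ne_zero_of_sum_ne_zero (by rw [h6]; exact one_ne_zero)
  have hlt : ∑ j, S ^ 2 * U a j ^ 2 < ∑ j, (U a j * (Λ j - T a a)) ^ 2 := by
    have hsq : ∀ j, S ^ 2 < (Λ j - T a a) ^ 2 := by
      intro j
      rw [← sq_abs (Λ j - T a a), abs_sub_comm]
      exact pow_lt_pow_left₀ (hcon j) hS0 two_ne_zero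
    refine Finset.sum_lt_sum (fun j _ => ?_) ⟨j, Finset.mem_univ j, ?_⟩
    · rw [mul_pow, mul_comm]
      exact mul_le_mul_of_nonneg_left (hsq j).le (sq_nonneg _)
    · rw [mul_pow, mul_comm]
      exact mul_lt_mul_of_pos_left (hsq j) (lt_of_le_of_ne (sq_nonneg _) (Ne.symm hj))
  rw [← Finset.mul_sum, h6, mul_one] at hlt
  linarith

/-- Entries inside the clusters are of second order in the off-diagonal norm. -/
theorem energy_inCluster_le {n : ℕ} {T : Matrix (Fin n) (Fin n) ℝ} (hT : T.IsSymm)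
    {cl : Fin n → ℝ} {D : ℝ} (hD : 0 < D)
    (h : ∀ a b, a ≠ b → cl a = cl b → T a b ^ 2 ≤ offRow T a * offRow T b / D ^ 2) :
    energy (InCluster cl 0) T ≤ energy (InBox 0 n) T *
      (energy (InBox 0 n) T + energy (InCluster cl 0) T) / (2 * D ^ 2) := by
  classical
  set e := energy (InCluster cl 0) T with he
  set w : Fin n → ℝ := fun a => ∑ b, if cl a = cl b then offRow T b else 0 with hw
  have h1 : ∀ a, 2 * w a ≤ energy (InBox 0 n) T + e := by
    intro a
    have e1 : w a = ∑ b, ∑ m, if cl a = cl b ∧ b ≠ m then T b m ^ 2 else 0 := by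
      refine Finset.sum_congr rfl fun b _ => ?_
      split_ifs with hb
      · rw [offRow, ← Finset.sum_filter]
        refine Finset.sum_congr ?_ fun _ _ => rfl
        ext m; simp [hb, eq_comm]
      · simp [hb]
    have e2 : w a = ∑ b, ∑ m, if cl a = cl m ∧ b ≠ m then T b m ^ 2 else 0 := by
      rw [e1, Finset.sum_comm]
      refine Finset.sum_congr rfl fun b _ => Finset.sum_congr rfl fun m _ => ?_
      simp only [hT.apply b m, ne_comm]
    have e3 : w a + w a ≤ energy (InBox 0 n) T + e := by
      nth_rewrite 1 [e1]
      rw [e2, he]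
      unfold energy
      rw [← Finset.sum_add_distrib, ← Finset.sum_add_distrib]
      refine Finset.sum_le_sum fun b _ => ?_
      rw [← Finset.sum_add_distrib, ← Finset.sum_add_distrib]
      refine Finset.sum_le_sum fun m _ => ?_
      by_cases hbm : b = m
      · simp [hbm, InBox, InCluster]
      · have p := sq_nonneg (T b m)
        have q : InBox 0 n b m := ⟨hbm, by omega, by omega⟩
        by_cases hb : cl a = cl b
        · by_cases hm : cl a = cl m
          · have q' : InCluster cl 0 b m := ⟨hbm, hb.symm.trans hm, by omega, by omega⟩
            rw [if_pos ⟨hb, hbm⟩, if_pos ⟨hm, hbm⟩, if_pos q, if_pos q']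
          · rw [if_pos ⟨hb, hbm⟩, if_neg fun h => hm h.1, if_pos q]
            split_ifs <;> linarith
        · rw [if_neg fun h => hb h.1, if_pos q]
          split_ifs <;> linarith
    linarith
  have h2 : e ≤ ∑ a, offRow T a * w a / D ^ 2 := by
    rw [he]
    unfold energy
    refine Finset.sum_le_sum fun a _ => ?_
    rw [hw, Finset.mul_sum, Finset.sum_div]
    refine Finset.sum_le_sum fun b _ => ?_
    have p : 0 ≤ offRow T a * offRow T b / D ^ 2 := by
      have := offRow_nonneg T a; have := offRow_nonneg T b; positivity
    by_cases hP : InCluster cl 0 a b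
    · rw [if_pos hP, if_pos hP.2.1]
      exact h a b hP.1 hP.2.1
    · rw [if_neg hP]
      split_ifs
      · exact p
      · simp
  refine h2.trans ?_
  rw [← sum_offRow, Finset.sum_mul, Finset.sum_div]
  refine Finset.sum_le_sum fun a _ => ?_
  rw [sum_offRow]
  have p := offRow_nonneg T a
  have : offRow T a * w a / D ^ 2 = offRow T a * (2 * w a) / (2 * D ^ 2) := by field_simp
  rw [this]
  have := h1 a
  gcongr

theorem sq_frobNorm_off {n : ℕ} (T : Matrix (Fin n) (Fin n) ℝ) :
    frobNorm (off T) ^ 2 = energy (InBox 0 n) T := by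
  unfold frobNorm energy
  refine (Real.sq_sqrt
    (Finset.sum_nonneg fun _ _ => Finset.sum_nonneg fun _ _ => sq_nonneg _)).trans ?_
  refine Finset.sum_congr rfl fun a _ => Finset.sum_congr rfl fun b _ => ?_
  by_cases hab : a = b
  · subst hab; simp [off, InBox]
  · have : InBox 0 n a b := ⟨hab, by omega, by omega⟩
    simp [off, this, hab]

theorem frobNorm_nonneg {n : ℕ} (T : Matrix (Fin n) (Fin n) ℝ) : 0 ≤ frobNorm T :=
  Real.sqrt_nonneg _

theorem frobNorm_off_jacobiIterate_le_self {n : ℕ} (ν : ℝ) {T : Matrix (Fin n) (Fin n) ℝ}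
    (hT : T.IsSymm) : frobNorm (off (jacobiIterate ν T (n * (n - 1) / 2))) ≤ frobNorm (off T) := by
  obtain ⟨G, c, s, hG, h0, hn⟩ := exists_isSweep ν hT
  refine le_of_sq_le_sq ?_ (frobNorm_nonneg _)
  rw [sq_frobNorm_off, sq_frobNorm_off, ← hn, ← h0]
  exact hG.energy_inBox_zero_le le_rfl

theorem contiguous_of_monotone_or_antitone {n : ℕ} {D cl : Fin n → ℝ}
    (hD : Monotone D ∨ Antitone D) {r d : ℝ} (hr : 2 * r < d) (hcl : ∀ a, |cl a - D a| ≤ r)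
    (hgap : ∀ a b, cl a ≠ cl b → d ≤ |cl a - cl b|) (i m k : Fin n) (him : i < m) (hmk : m < k)
    (h : cl k = cl i) : cl m = cl i := by
  have key : ∀ a b, D a ≤ D b → cl a ≤ cl b := by
    intro a b hab
    by_contra! hlt
    have g := hgap a b hlt.ne'
    rw [abs_of_pos (by linarith)] at g
    have ha := abs_le.mp (hcl a)
    have hb := abs_le.mp (hcl b)
    linarith [ha.2, hb.1]
  rcases hD with hD | hD
  · exact le_antisymm (h ▸ key m k (hD hmk.le)) (key i m (hD him.le))
  · exact le_antisymm (key m i (hD him.le)) (h ▸ key k m (hD hmk.le))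

theorem quadratic_bound_arith {n : ℕ} {S d : ℝ} (hS : 0 ≤ S) (hd : 0 < d)
    (hsmall : 1000 * (n + 1 : ℝ) ^ 3 * S ≤ d) :
    3 / 4 * (S ^ 2 / d) + S ^ 2 / (97 / 100 * d) +
      n * (n * (4 * n * (S / (97 / 100 * d)) ^ 2 * S)) ≤ Real.sqrt (34 / 9) / d * S ^ 2 := by
  have h1 : (1.94 : ℝ) ≤ Real.sqrt (34 / 9) := by
    apply Real.le_sqrt_of_sq_le; norm_num
  have hn3 : (n : ℝ) ^ 3 * S ≤ d / 1000 := by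
    have : (n : ℝ) ^ 3 * S ≤ (n + 1 : ℝ) ^ 3 * S := by gcongr; linarith
    linarith
  have e1 : n * (n * (4 * n * (S / (97 / 100 * d)) ^ 2 * S)) =
      4 * (100 / 97) ^ 2 * (n ^ 3 * S) * (S ^ 2 / d) / d := by field_simp
  have e2 : n * (n * (4 * n * (S / (97 / 100 * d)) ^ 2 * S)) ≤ 5 / 1000 * (S ^ 2 / d) := by
    rw [e1, div_le_iff₀ hd]
    have p : 0 ≤ S ^ 2 / d := by positivity
    have := mul_le_mul_of_nonneg_right hn3 p
    have : 0 ≤ (S ^ 2 / d) * d := by positivity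
    nlinarith
  have e3 : S ^ 2 / (97 / 100 * d) = 100 / 97 * (S ^ 2 / d) := by field_simp
  have p : 0 ≤ S ^ 2 / d := by positivity
  have e4 : Real.sqrt (34 / 9) / d * S ^ 2 = Real.sqrt (34 / 9) * (S ^ 2 / d) := by ring
  rw [e3, e4]
  have := mul_le_mul_of_nonneg_right h1 p
  linarith

/-- Quadratic convergence of a sweep of the Jacobi iteration for a matrix that is close to a
diagonal matrix with ordered diagonal entries. -/
theorem frobNorm_off_jacobiIterate_le {n : ℕ} (ν : ℝ) {T : Matrix (Fin n) (Fin n) ℝ}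
    (hT : T.IsSymm) {d κ : ℝ} (hd : 0 < d)
    (hgap : ∀ l ∈ spectrum ℝ T, ∀ m ∈ spectrum ℝ T, l ≠ m → d ≤ |l - m|)
    {D : Fin n → ℝ} (hD : Monotone D ∨ Antitone D) (hTD : ∀ a, |T a a - D a| ≤ κ)
    (hκ : 2 * (frobNorm (off T) + κ) < d)
    (hsmall : 1000 * (n + 1 : ℝ) ^ 3 * frobNorm (off T) ≤ d) :
    frobNorm (off (jacobiIterate ν T (n * (n - 1) / 2))) ≤
      Real.sqrt (34 / 9) / d * frobNorm (off T) ^ 2 := by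
  obtain ⟨G, c, s, hG, h0, hn⟩ := exists_isSweep ν hT
  obtain ⟨U, Λ, hΛ, h1, h2, h3⟩ := exists_spectral_decomposition hT
  set S := frobNorm (off T) with hSdef
  have hS0 : 0 ≤ S := frobNorm_nonneg _
  have hS : energy (InBox 0 n) T = S ^ 2 := (sq_frobNorm_off T).symm
  have hn1 : (1 : ℝ) ≤ (n + 1 : ℝ) ^ 3 := one_le_pow₀ (by linarith [n.cast_nonneg (α := ℝ)])
  have hSd : 1000 * S ≤ d := by
    have := mul_le_mul_of_nonneg_right hn1 hS0
    linarith
  choose j hj using exists_eigenvalue_near_diag h1 h2 h3 hS0 hS.le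
  set cl : Fin n → ℝ := fun a => Λ (j a) with hcl
  have hclgap : ∀ a b, cl a ≠ cl b → d ≤ |cl a - cl b| := fun a b hab =>
    hgap _ (hΛ _) _ (hΛ _) hab
  have hcont := contiguous_of_monotone_or_antitone hD hκ (cl := cl) (fun a => by
    have h := abs_sub_le (cl a) (T a a) (D a)
    have := hTD a
    have := hj a
    rw [abs_sub_comm] at this
    linarith) hclgap
  have hD0 : 0 < (d - S) ^ 2 / d := by
    have : 0 < d - S := by linarith
    positivity
  have hD1 : 99 / 100 * d ≤ (d - S) ^ 2 / d := by
    rw [le_div_iff₀ hd]; nlinarith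
  have hin := energy_inCluster_le hT (cl := cl) hD0 fun a b hab hc =>
    sq_apply_le_offRow_mul h1 h2 h3 hd (by linarith) hS0
      (l := cl a) (fun j' hj' => hgap _ (hΛ _) _ (hΛ _) hj') hab (hj a) (by rw [hc]; exact hj b)
  have hq : energy (InCluster cl 0) T ≤ (3 / 4 * (S ^ 2 / d)) ^ 2 := by
    rw [hS] at hin
    set e := energy (InCluster cl 0) T with he
    have he0 : 0 ≤ e := energy_nonneg _ _
    have hle : e ≤ S ^ 2 * (S ^ 2 + e) / (2 * (99 / 100 * d) ^ 2) := hin.trans (by gcongr)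
    rw [le_div_iff₀ (by positivity)] at hle
    have hS2 : S ^ 2 ≤ d ^ 2 / 100 := by nlinarith
    have hm := mul_le_mul_of_nonneg_right hS2 he0
    have e1 : (3 / 4 * (S ^ 2 / d)) ^ 2 = 9 / 16 * (S ^ 2 * S ^ 2) / d ^ 2 := by
      field_simp; ring
    rw [e1, le_div_iff₀ (by positivity)]
    nlinarith [mul_nonneg (sq_nonneg S) (sq_nonneg S)]
  have hfinal := hG.energy_le hcont hS0 (d := 97 / 100 * d) (q := 3 / 4 * (S ^ 2 / d))
    (by positivity) (by positivity) (by rw [h0, hS]) (by rw [h0]; exact hq) fun a b hab => by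
      rw [h0]
      have g := hclgap a b hab
      have ha := hj a
      have hb := hj b
      have t1 := abs_sub_le (cl a) (T a a) (cl b)
      have t2 := abs_sub_le (T a a) (T b b) (cl b)
      rw [abs_sub_comm] at ha
      have hnn : (n : ℝ) * (n + 1) ≤ (n + 1 : ℝ) ^ 3 := by
        nlinarith [n.cast_nonneg (α := ℝ), sq_nonneg (n : ℝ), pow_nonneg (n.cast_nonneg (α := ℝ)) 3]
      have := mul_le_mul_of_nonneg_right hnn hS0
      simp only [hcl] at g t1 t2
      linarith
  rw [hn, ← sq_frobNorm_off] at hfinal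
  exact (le_of_sq_le_sq hfinal (by positivity)).trans (quadratic_bound_arith hS0 hd hsmall)

/-! ### Rounding errors of sums and inner products -/

theorem Rnd.abs_error_le {u x c : ℝ} (h : Rnd u x c) : |c - x| ≤ u * |x| := by
  obtain ⟨δ, hδ, rfl⟩ := h
  rw [show x * (1 + δ) - x = δ * x by ring, abs_mul]
  gcongr

theorem Rnd.abs_value_le {u x c : ℝ} (h : Rnd u x c) : |c| ≤ (1 + u) * |x| := by
  have h1 := h.abs_error_le
  have h2 := abs_sub_abs_le_abs_sub c x
  linarith

theorem Rnd.abs_ge {u x c : ℝ} (h : Rnd u x c) : (1 - u) * |x| ≤ |c| := by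
  have h1 := h.abs_error_le
  have h2 := abs_sub_abs_le_abs_sub x c
  rw [abs_sub_comm] at h2
  linarith

theorem Rnd.ge_of_nonneg {u x c : ℝ} (h : Rnd u x c) (hx : 0 ≤ x) : (1 - u) * x ≤ c := by
  have h1 := h.abs_error_le
  rw [abs_of_nonneg hx] at h1
  linarith [(abs_le.mp h1).1]

theorem FlSum.card_pos {u : ℝ} {s : Multiset ℝ} {c : ℝ} (h : FlSum u s c) : 1 ≤ s.card := by
  induction h with
  | single x => simp
  | add hs ht hc ih1 ih2 => rw [Multiset.card_add]; omega

theorem FlSum.abs_error_le {u : ℝ} (hu : 0 ≤ u) {s : Multiset ℝ} {c : ℝ} (h : FlSum u s c) :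
    |c - s.sum| ≤ ((1 + u) ^ s.card - 1) * (s.map fun x => |x|).sum := by
  induction h with
  | single x => simp; positivity
  | @add s t a b c hs ht hc ih1 ih2 =>
    rw [Multiset.card_add, Multiset.map_add, Multiset.sum_add, Multiset.sum_add]
    have hA := Multiset.abs_sum_le_sum_abs (s := s)
    have hB := Multiset.abs_sum_le_sum_abs (s := t)
    set A := (s.map fun x => |x|).sum
    set B := (t.map fun x => |x|).sum
    have hA0 : 0 ≤ A := (abs_nonneg _).trans hA
    have hB0 : 0 ≤ B := (abs_nonneg _).trans hB
    have h1 := hs.card_pos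
    have h2 := ht.card_pos
    obtain ⟨N, hN⟩ : ∃ N, s.card + t.card = N + 1 := ⟨s.card + t.card - 1, by omega⟩
    have hp1 : (1 + u) ^ s.card ≤ (1 + u) ^ N := pow_le_pow_right₀ (by linarith) (by omega)
    have hp2 : (1 + u) ^ t.card ≤ (1 + u) ^ N := pow_le_pow_right₀ (by linarith) (by omega)
    have e1 : |a - s.sum| ≤ ((1 + u) ^ N - 1) * A :=
      ih1.trans (mul_le_mul_of_nonneg_right (by linarith) hA0)
    have e2 : |b - t.sum| ≤ ((1 + u) ^ N - 1) * B :=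
      ih2.trans (mul_le_mul_of_nonneg_right (by linarith) hB0)
    have e3 := hc.abs_error_le
    have e4 : |a + b - (s.sum + t.sum)| ≤ ((1 + u) ^ N - 1) * (A + B) := by
      rw [show a + b - (s.sum + t.sum) = (a - s.sum) + (b - t.sum) by ring]
      exact (abs_add_le _ _).trans (by linarith)
    have e5 : |a + b| ≤ (1 + u) ^ N * (A + B) := by
      have := abs_sub_abs_le_abs_sub (a + b) (s.sum + t.sum)
      have := abs_add_le s.sum t.sum
      linarith
    rw [hN, pow_succ]
    have e6 := abs_sub_le c (a + b) (s.sum + t.sum)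
    have e7 := mul_le_mul_of_nonneg_left e5 hu
    nlinarith

theorem FlSum.ge_of_nonneg {u : ℝ} (hu : 0 ≤ u) (hu1 : u ≤ 1) {s : Multiset ℝ} {c : ℝ}
    (h : FlSum u s c) (hs : ∀ x ∈ s, 0 ≤ x) : (1 - u) ^ s.card * s.sum ≤ c ∧ 0 ≤ s.sum := by
  induction h with
  | single x =>
    have hx := hs x (by simp)
    simp only [Multiset.card_singleton, pow_one, Multiset.sum_singleton]
    exact ⟨by nlinarith, hx⟩
  | @add s t a b c hs' ht hc ih1 ih2 =>
    obtain ⟨f1, g1⟩ := ih1 fun x hx => hs x (by simp [hx])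
    obtain ⟨f2, g2⟩ := ih2 fun x hx => hs x (by simp [hx])
    rw [Multiset.card_add, Multiset.sum_add]
    refine ⟨?_, by linarith⟩
    have hu' : 0 ≤ 1 - u := by linarith
    have h1 := hs'.card_pos
    have h2 := ht.card_pos
    obtain ⟨N, hN⟩ : ∃ N, s.card + t.card = N + 1 := ⟨s.card + t.card - 1, by omega⟩
    have hp1 : (1 - u) ^ N ≤ (1 - u) ^ s.card :=
      pow_le_pow_of_le_one hu' (by linarith) (by omega)
    have hp2 : (1 - u) ^ N ≤ (1 - u) ^ t.card :=
      pow_le_pow_of_le_one hu' (by linarith) (by omega)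
    have e1 := (mul_le_mul_of_nonneg_right hp1 g1).trans f1
    have e2 := (mul_le_mul_of_nonneg_right hp2 g2).trans f2
    have p : 0 ≤ (1 - u) ^ N := by positivity
    have hab : (1 - u) ^ N * (s.sum + t.sum) ≤ a + b := by linarith
    have hab0 : 0 ≤ a + b := le_trans (by positivity) hab
    rw [hN, pow_succ]
    calc _ = (1 - u) * ((1 - u) ^ N * (s.sum + t.sum)) := by ring
      _ ≤ (1 - u) * (a + b) := by gcongr
      _ ≤ c := hc.ge_of_nonneg hab0

theorem one_add_pow_sub_one_le {u : ℝ} (hu : 0 ≤ u) (hu1 : u ≤ 1) (m : ℕ) :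
    (1 + u) ^ m - 1 ≤ (2 ^ m - 1) * u := by
  induction m with
  | zero => simp
  | succ m ih =>
    have h2 : (1 : ℝ) ≤ 2 ^ m := one_le_pow₀ (by norm_num)
    have h3 : (1 + u) * ((1 + u) ^ m - 1) ≤ 2 * ((2 ^ m - 1) * u) :=
      mul_le_mul (by linarith) ih (by linarith [one_le_pow₀ (by linarith : 1 ≤ 1 + u) (n := m)])
        (by norm_num)
    rw [pow_succ, pow_succ]
    linarith

theorem FlDot.abs_error_le {n : ℕ} {u : ℝ} (hu : 0 ≤ u) (hu1 : u ≤ 1) {x y : Fin n → ℝ} {r : ℝ}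
    (h : FlDot u x y r) : |r - ∑ i, x i * y i| ≤ 2 ^ (n + 1) * u * ∑ i, |x i * y i| := by
  obtain ⟨m, hm, hr⟩ := h
  have h1 := hr.abs_error_le hu
  simp only [Multiset.card_map, Finset.card_val, Finset.card_univ, Fintype.card_fin,
    Multiset.map_map, Function.comp_def] at h1
  change |r - ∑ i, m i| ≤ ((1 + u) ^ n - 1) * ∑ i, |m i| at h1
  have h2 : ∑ i, |m i| ≤ (1 + u) * ∑ i, |x i * y i| := by
    rw [Finset.mul_sum]; exact Finset.sum_le_sum fun i _ => (hm i).abs_value_le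
  have h3 : |∑ i, m i - ∑ i, x i * y i| ≤ u * ∑ i, |x i * y i| := by
    rw [← Finset.sum_sub_distrib, Finset.mul_sum]
    exact (Finset.abs_sum_le_sum_abs _ _).trans (Finset.sum_le_sum fun i _ => (hm i).abs_error_le)
  have hs : 0 ≤ ∑ i, |x i * y i| := Finset.sum_nonneg fun _ _ => abs_nonneg _
  have hp : 0 ≤ (1 + u) ^ n - 1 := by linarith [one_le_pow₀ (by linarith : 1 ≤ 1 + u) (n := n)]
  have h4 := mul_le_mul_of_nonneg_left h2 hp
  have h5 := mul_le_mul_of_nonneg_right (one_add_pow_sub_one_le hu hu1 (n + 1)) hs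
  have h6 := abs_sub_le r (∑ i, m i) (∑ i, x i * y i)
  rw [pow_succ (1 + u)] at h5
  nlinarith [mul_nonneg hu hs]

theorem FlDot.ge_self {n : ℕ} {u : ℝ} (hu : 0 ≤ u) (hu1 : u ≤ 1 / 2) {x : Fin n → ℝ} {r : ℝ}
    (h : FlDot u x x r) (i : Fin n) : (1 / 2) ^ (n + 1) * x i ^ 2 ≤ r := by
  obtain ⟨m, hm, hr⟩ := h
  have hm' : ∀ i, (1 - u) * (x i * x i) ≤ m i := fun i =>
    (hm i).ge_of_nonneg (mul_self_nonneg _)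
  have hm0 : ∀ i, 0 ≤ m i := fun i =>
    le_trans (mul_nonneg (by linarith) (mul_self_nonneg _)) (hm' i)
  have h1 := (hr.ge_of_nonneg hu (by linarith) (by simpa using hm0)).1
  simp only [Multiset.card_map, Finset.card_val, Finset.card_univ, Fintype.card_fin] at h1
  change (1 - u) ^ n * ∑ i, m i ≤ r at h1
  have h2 := Finset.single_le_sum (fun i _ => hm0 i) (Finset.mem_univ i)
  have h3 : (1 / 2 : ℝ) ^ n ≤ (1 - u) ^ n := pow_le_pow_left₀ (by norm_num) (by linarith) n
  calc _ = (1 / 2) ^ n * (1 / 2 * (x i * x i)) := by ring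
    _ ≤ (1 / 2) ^ n * m i := by
      have := hm' i
      have := mul_self_nonneg (x i)
      gcongr
      nlinarith
    _ ≤ (1 - u) ^ n * ∑ i, m i := by
      have := hm0 i
      have : 0 ≤ (1 - u) ^ n := le_trans (by positivity) h3
      gcongr
    _ ≤ r := h1

/-! ### Modified Gram-Schmidt orthogonalization of a nearly orthogonal matrix -/

/-- The computed columns are bounded, whatever the input. -/
theorem IsComputedMGS.abs_apply_le {n : ℕ} {u : ℝ} (hu : 0 ≤ u) (hu1 : u ≤ 1 / 2)
    {Z Q : Matrix (Fin n) (Fin n) ℝ} (h : IsComputedMGS u Z Q) (i k : Fin n) :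
    |Q i k| ≤ 2 ^ (n + 3) := by
  obtain ⟨V, R, -, h1, h2, h3, -⟩ := h
  obtain ⟨σ, hσ, hR⟩ := h1 k
  have g1 := hσ.ge_self hu hu1 i
  have g2 : (1 / 2) ^ (n + 1) * |V k i k| ≤ Real.sqrt σ := by
    refine Real.le_sqrt_of_sq_le (le_trans ?_ g1)
    rw [mul_pow, sq_abs]
    refine mul_le_mul_of_nonneg_right ?_ (sq_nonneg _)
    rw [sq]
    exact mul_le_of_le_one_left (by positivity) (pow_le_one₀ (by norm_num) (by norm_num))
  have g3 := hR.abs_ge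
  rw [abs_of_nonneg (Real.sqrt_nonneg σ)] at g3
  have g4 : (1 / 2) ^ (n + 2) * |V k i k| ≤ |R k k| := by
    refine le_trans ?_ g3
    have : 1 / 2 * Real.sqrt σ ≤ (1 - u) * Real.sqrt σ := by
      have := Real.sqrt_nonneg σ
      gcongr; linarith
    refine le_trans ?_ this
    rw [pow_succ]; linarith
  have g5 := (h3 k i).abs_value_le
  have hR0 : 0 < |R k k| := abs_pos.mpr (h2 k)
  have g6 : |V k i k / R k k| ≤ 2 ^ (n + 2) := by
    rw [abs_div, div_le_iff₀ hR0]
    calc |V k i k| = 2 ^ (n + 2) * ((1 / 2) ^ (n + 2) * |V k i k|) := by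
          rw [← mul_assoc, ← mul_pow]; norm_num
      _ ≤ _ := by gcongr
  calc |Q i k| ≤ (1 + u) * |V k i k / R k k| := g5
    _ ≤ 2 * 2 ^ (n + 2) := by gcongr; linarith
    _ = _ := by ring

theorem abs_sqrt_sub_one_le (x : ℝ) : |Real.sqrt x - 1| ≤ |x - 1| := by
  rcases le_total x 0 with hx | hx
  · rw [Real.sqrt_eq_zero_of_nonpos hx, abs_of_nonpos (by linarith : x - 1 ≤ 0)]
    norm_num; linarith
  · have h := Real.sq_sqrt hx
    have h0 := Real.sqrt_nonneg x
    have : x - 1 = (Real.sqrt x - 1) * (Real.sqrt x + 1) := by linarith [h]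
    rw [this, abs_mul]
    refine le_mul_of_one_le_right (abs_nonneg _) ?_
    rw [abs_of_nonneg (by linarith)]; linarith

/-- Normalizing a perturbed unit vector in floating-point arithmetic. -/
theorem exists_normalize_bound (n : ℕ) {C : ℝ} (hC : 0 ≤ C) :
    ∃ K υ₀ : ℝ, 0 ≤ K ∧ 0 < υ₀ ∧ ∀ (u υ σ R : ℝ) (x w q : Fin n → ℝ), 0 ≤ u → u ≤ υ → υ ≤ υ₀ →
      (∀ i, |w i| ≤ 1) → ∑ i, w i * w i = 1 → (∀ i, |x i - w i| ≤ C * υ) →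
      FlDot u x x σ → Rnd u (Real.sqrt σ) R → (∀ i, Rnd u (x i / R) (q i)) →
      ∀ i, |q i - w i| ≤ K * υ := by
  set K₂ : ℝ := 4 * n * 2 ^ (n + 1) + 3 * n * C with hK₂
  have hK₂0 : 0 ≤ K₂ := by positivity
  set K₃ : ℝ := 2 * K₂ + 1 with hK₃
  refine ⟨2 * (C + K₃) + 4, 1 / (2 * K₃ + C + 1), by positivity, by positivity, ?_⟩
  intro u υ σ R x w q hu huυ hυ hw hw1 hx hσ hR hq i
  have hυ0 : 0 ≤ υ := hu.trans huυ
  rw [le_div_iff₀ (by positivity)] at hυ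
  have hCυ : 0 ≤ C * υ := by positivity
  have hKυ : 0 ≤ K₃ * υ := by positivity
  have hC1 : C * υ ≤ 1 := by linarith
  have hK1 : K₃ * υ ≤ 1 / 2 := by linarith
  have hυ1 : υ ≤ 1 := by linarith
  have hx2 : ∀ i, |x i| ≤ 2 := fun i => by
    have := abs_sub_abs_le_abs_sub (x i) (w i)
    linarith [hx i, hw i]
  have s1 : |∑ i, x i * x i - 1| ≤ 3 * n * C * υ := by
    rw [← hw1, ← Finset.sum_sub_distrib]
    refine (Finset.abs_sum_le_sum_abs _ _).trans ?_
    calc _ ≤ ∑ _i : Fin n, 3 * (C * υ) := by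
          refine Finset.sum_le_sum fun i _ => ?_
          rw [show x i * x i - w i * w i = (x i + w i) * (x i - w i) by ring, abs_mul]
          have h1 := abs_add_le (x i) (w i)
          exact mul_le_mul (by linarith [hx2 i, hw i]) (hx i) (abs_nonneg _) (by norm_num)
      _ = _ := by simp; ring
  have s2 : ∑ i, |x i * x i| ≤ 4 * n := by
    calc _ ≤ ∑ _i : Fin n, (4 : ℝ) := by
          refine Finset.sum_le_sum fun i _ => ?_
          rw [abs_mul]
          nlinarith [hx2 i, abs_nonneg (x i)]
      _ = _ := by simp; ring
  have s3 : |σ - 1| ≤ K₂ * υ := by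
    have e := hσ.abs_error_le hu (huυ.trans hυ1)
    have e2 : 2 ^ (n + 1) * u * ∑ i, |x i * x i| ≤ 2 ^ (n + 1) * υ * (4 * n) := by gcongr
    have e3 := abs_sub_le σ (∑ i, x i * x i) 1
    have e4 : K₂ * υ = 2 ^ (n + 1) * υ * (4 * n) + 3 * n * C * υ := by rw [hK₂]; ring
    linarith
  have s4 : |R - 1| ≤ K₃ * υ := by
    have e1 := (abs_sqrt_sub_one_le σ).trans s3
    have e2 := hR.abs_error_le
    rw [abs_of_nonneg (Real.sqrt_nonneg σ)] at e2
    have e3 := abs_sub_le R (Real.sqrt σ) 1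
    have e4 := (abs_le.mp e1).2
    have e5 : u * Real.sqrt σ ≤ υ * (1 + K₂ * υ) := by
      have := Real.sqrt_nonneg σ
      gcongr; linarith
    have e6 : K₂ * υ * υ ≤ K₂ * υ := mul_le_of_le_one_right (by positivity) hυ1
    rw [hK₃]; nlinarith
  have hRpos : 1 / 2 ≤ R := by linarith [(abs_le.mp s4).1]
  have hR0 : 0 < R := by linarith
  have s5 : |x i / R| ≤ 4 := by
    rw [abs_div, abs_of_pos hR0, div_le_iff₀ hR0]; linarith [hx2 i]
  have s6 : |x i / R - w i| ≤ 2 * (C + K₃) * υ := by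
    have e : x i / R - w i = ((x i - w i) - w i * (R - 1)) / R := by field_simp; ring
    rw [e, abs_div, abs_of_pos hR0, div_le_iff₀ hR0]
    have e1 := abs_sub (x i - w i) (w i * (R - 1))
    rw [abs_mul] at e1
    have e2 := mul_le_mul (hw i) s4 (abs_nonneg _) zero_le_one
    have e3 : (C + K₃) * υ ≤ 2 * (C + K₃) * υ * R := by
      have : 0 ≤ (C + K₃) * υ := by positivity
      nlinarith
    linarith [hx i]
  have s7 := (hq i).abs_error_le
  have s8 : u * |x i / R| ≤ υ * 4 := by gcongr
  have s9 := abs_sub_le (q i) (x i / R) (w i)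
  nlinarith

/-- Orthogonalizing a perturbed vector against a perturbed unit vector. -/
theorem exists_orthogonalize_bound (n : ℕ) {C : ℝ} (hC : 0 ≤ C) :
    ∃ K υ₀ : ℝ, 0 ≤ K ∧ 0 < υ₀ ∧ ∀ (u υ r : ℝ) (q w y w' m y' : Fin n → ℝ),
      0 ≤ u → u ≤ υ → υ ≤ υ₀ → (∀ i, |w i| ≤ 1) → (∀ i, |w' i| ≤ 1) →
      ∑ i, w i * w' i = 0 → (∀ i, |q i - w i| ≤ C * υ) → (∀ i, |y i - w' i| ≤ C * υ) →
      FlDot u q y r → (∀ i, Rnd u (r * q i) (m i)) → (∀ i, Rnd u (y i - m i) (y' i)) →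
      ∀ i, |y' i - w' i| ≤ K * υ := by
  set K₅ : ℝ := 3 * n * C + 4 * n * 2 ^ (n + 1) with hK₅
  have hK₅0 : 0 ≤ K₅ := by positivity
  refine ⟨2 + 8 * K₅ + C, 1 / (C + 1), by positivity, by positivity, ?_⟩
  intro u υ r q w y w' m y' hu huυ hυ hw hw' hww hq hy hr hm hy' i
  have hυ0 : 0 ≤ υ := hu.trans huυ
  rw [le_div_iff₀ (by positivity)] at hυ
  have hCυ : 0 ≤ C * υ := by positivity
  have hC1 : C * υ ≤ 1 := by linarith
  have hυ1 : υ ≤ 1 := by linarith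
  have hu1 : u ≤ 1 := huυ.trans hυ1
  have hq2 : ∀ i, |q i| ≤ 2 := fun i => by
    have := abs_sub_abs_le_abs_sub (q i) (w i)
    linarith [hq i, hw i]
  have hy2 : ∀ i, |y i| ≤ 2 := fun i => by
    have := abs_sub_abs_le_abs_sub (y i) (w' i)
    linarith [hy i, hw' i]
  have s1 : |∑ i, q i * y i| ≤ 3 * n * C * υ := by
    have : ∑ i, q i * y i = ∑ i, (q i * y i - w i * w' i) := by
      rw [Finset.sum_sub_distrib, hww, sub_zero]
    rw [this]
    refine (Finset.abs_sum_le_sum_abs _ _).trans ?_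
    calc _ ≤ ∑ _i : Fin n, 3 * (C * υ) := by
          refine Finset.sum_le_sum fun i _ => ?_
          rw [show q i * y i - w i * w' i = (q i - w i) * y i + w i * (y i - w' i) by ring]
          refine (abs_add_le _ _).trans ?_
          rw [abs_mul, abs_mul]
          have e1 := mul_le_mul (hq i) (hy2 i) (abs_nonneg _) hCυ
          have e2 := mul_le_mul (hw i) (hy i) (abs_nonneg _) zero_le_one
          linarith
      _ = _ := by simp; ring
  have s2 : ∑ i, |q i * y i| ≤ 4 * n := by
    calc _ ≤ ∑ _i : Fin n, (4 : ℝ) := by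
          refine Finset.sum_le_sum fun i _ => ?_
          rw [abs_mul]
          have := mul_le_mul (hq2 i) (hy2 i) (abs_nonneg _) (by norm_num)
          linarith
      _ = _ := by simp; ring
  have s3 : |r| ≤ K₅ * υ := by
    have e := hr.abs_error_le hu hu1
    have e2 : 2 ^ (n + 1) * u * ∑ i, |q i * y i| ≤ 2 ^ (n + 1) * υ * (4 * n) := by gcongr
    have e3 := abs_sub_abs_le_abs_sub r (∑ i, q i * y i)
    have e4 : K₅ * υ = 3 * n * C * υ + 2 ^ (n + 1) * υ * (4 * n) := by rw [hK₅]; ring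
    linarith
  have s4 : |m i| ≤ 4 * K₅ * υ := by
    have e := (hm i).abs_value_le
    rw [abs_mul] at e
    have e2 := mul_le_mul s3 (hq2 i) (abs_nonneg _) (by positivity)
    have e3 := mul_le_mul (by linarith : 1 + u ≤ 2) e2 (by positivity) (by norm_num)
    linarith
  have s5 := (hy' i).abs_error_le
  have s6 : |y i - m i| ≤ 2 + 4 * K₅ * υ := (abs_sub _ _).trans (by linarith [hy2 i])
  have s7 : u * |y i - m i| ≤ υ * (2 + 4 * K₅ * υ) := by gcongr
  have s8 : K₅ * υ * υ ≤ K₅ * υ := mul_le_of_le_one_right (by positivity) hυ1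
  have s9 := abs_sub_le (y' i) (y i - m i) (w' i)
  have s10 : |y i - m i - w' i| ≤ C * υ + 4 * K₅ * υ := by
    rw [show y i - m i - w' i = (y i - w' i) - m i by ring]
    exact (abs_sub _ _).trans (by linarith [hy i])
  nlinarith

/-- Modified Gram-Schmidt orthogonalization changes a nearly orthogonal matrix by little. -/
theorem exists_mgs_bound (n : ℕ) {p : ℝ} (hp : 0 ≤ p) :
    ∃ K υ₀ : ℝ, 0 ≤ K ∧ 0 < υ₀ ∧ ∀ (u υ : ℝ) (W Z Q : Matrix (Fin n) (Fin n) ℝ),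
      0 ≤ u → u ≤ υ → υ ≤ υ₀ → W ∈ Matrix.orthogonalGroup (Fin n) ℝ →
      (∀ i j, |Z i j - W i j| ≤ p * υ) → IsComputedMGS u Z Q →
      ∀ i j, |Q i j - W i j| ≤ K * υ := by
  have key : ∀ k : ℕ, ∃ K υ₀ : ℝ, 0 ≤ K ∧ 0 < υ₀ ∧
      ∀ (u υ : ℝ) (W Q R : Matrix (Fin n) (Fin n) ℝ) (V : ℕ → Matrix (Fin n) (Fin n) ℝ),
      0 ≤ u → u ≤ υ → υ ≤ υ₀ → (∀ i j, |W i j| ≤ 1) →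
      (∀ j j', ∑ i, W i j * W i j' = if j = j' then 1 else 0) →
      (∀ i j, |V 0 i j - W i j| ≤ p * υ) →
      (∀ k : Fin n, ∃ σ : ℝ,
        FlDot u (fun i => V k i k) (fun i => V k i k) σ ∧ Rnd u (Real.sqrt σ) (R k k)) →
      (∀ k i : Fin n, Rnd u (V k i k / R k k) (Q i k)) →
      (∀ k j : Fin n, k < j → FlDot u (fun i => Q i k) (fun i => V k i j) (R k j)) →
      (∀ k j : Fin n, k < j → ∀ i : Fin n, ∃ m : ℝ,
        Rnd u (R k j * Q i k) m ∧ Rnd u (V k i j - m) (V (k + 1) i j)) →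
      (∀ i j : Fin n, k ≤ j → |V k i j - W i j| ≤ K * υ) ∧
      (∀ i j : Fin n, (j : ℕ) < k → |Q i j - W i j| ≤ K * υ) := by
    intro k
    induction k with
    | zero =>
      refine ⟨p, 1, hp, one_pos, ?_⟩
      intro u υ W Q R V _ _ _ _ _ hV _ _ _ _
      exact ⟨fun i j _ => hV i j, fun i j hj => absurd hj (Nat.not_lt_zero _)⟩
    | succ k ih =>
      obtain ⟨K, υ₀, hK, hυ₀, ih⟩ := ih
      obtain ⟨K₁, υ₁, hK₁, hυ₁, h1⟩ := exists_normalize_bound n hK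
      obtain ⟨K₂, υ₂, hK₂, hυ₂, h2⟩ := exists_orthogonalize_bound n (add_nonneg hK hK₁)
      refine ⟨K + K₁ + K₂, min υ₀ (min υ₁ υ₂), by positivity, by positivity, ?_⟩
      intro u υ W Q R V hu huυ hυ hW hWW hV hR hQ hdot hupd
      have hυ0 : 0 ≤ υ := hu.trans huυ
      rw [le_min_iff, le_min_iff] at hυ
      obtain ⟨ihV, ihQ⟩ := ih u υ W Q R V hu huυ hυ.1 hW hWW hV hR hQ hdot hupd
      have w0 : 0 ≤ K * υ := by positivity
      have w1 : 0 ≤ K₁ * υ := by positivity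
      have w2 : 0 ≤ K₂ * υ := by positivity
      have hcol : ∀ i j : Fin n, (j : ℕ) = k → |Q i j - W i j| ≤ K₁ * υ := by
        intro i j hj
        obtain ⟨σ, hσ, hRj⟩ := hR j
        exact h1 u υ σ (R j j) (fun i => V j i j) (fun i => W i j) (fun i => Q i j) hu huυ hυ.2.1
          (fun i => hW i j) (by simpa using hWW j j) (fun i => by rw [hj]; exact ihV i j hj.ge)
          hσ hRj (hQ j) i
      constructor
      · intro i j hj
        set k' : Fin n := ⟨k, by omega⟩ with hk'
        have hkj : k' < j := by rw [Fin.lt_def]; simp only [hk']; omega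
        choose m hm hm' using hupd k' j hkj
        have := h2 u υ (R k' j) (fun i => Q i k') (fun i => W i k') (fun i => V k i j)
          (fun i => W i j) m (fun i => V (k + 1) i j) hu huυ hυ.2.2 (fun i => hW i k')
          (fun i => hW i j) (by rw [hWW, if_neg hkj.ne])
          (fun i => by have := hcol i k' rfl; linarith)
          (fun i => by have := ihV i j (by omega); linarith) (hdot k' j hkj) hm hm' i
        linarith
      · intro i j hj
        by_cases hjk : (j : ℕ) = k
        · have := hcol i j hjk; linarith
        · have := ihQ i j (by omega); linarith
  obtain ⟨K, υ₀, hK, hυ₀, h⟩ := key n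
  refine ⟨K, υ₀, hK, hυ₀, ?_⟩
  intro u υ W Z Q hu huυ hυ hW hZ hQ i j
  obtain ⟨V, R, rfl, g1, -, g3, g4, g5⟩ := hQ
  refine (h u υ W Q R V hu huυ hυ (fun i j => by simpa using entry_norm_bound_of_unitary hW i j)
    (fun j j' => ?_) hZ g1 g3 g4 g5).2 i j j.2
  have h1 := congrFun (congrFun (Matrix.mem_orthogonalGroup_iff' (Fin n) ℝ |>.mp hW) j) j'
  simpa [Matrix.mul_apply, Matrix.one_apply, Matrix.star_apply] using h1

theorem specNorm_nonneg {n : ℕ} (M : Matrix (Fin n) (Fin n) ℝ) : 0 ≤ specNorm M := norm_nonneg _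

theorem abs_apply_le_specNorm {n : ℕ} (M : Matrix (Fin n) (Fin n) ℝ) (a b : Fin n) :
    |M a b| ≤ specNorm M := by
  have h1 := (Matrix.toEuclideanCLM (n := Fin n) (𝕜 := ℝ) M).le_opNorm
    (EuclideanSpace.single b (1 : ℝ))
  rw [PiLp.norm_single, norm_one, mul_one] at h1
  refine le_trans ?_ h1
  have h2 := PiLp.norm_apply_le
    (Matrix.toEuclideanCLM (n := Fin n) (𝕜 := ℝ) M (EuclideanSpace.single b (1 : ℝ))) a
  have h3 : Matrix.toEuclideanCLM (n := Fin n) (𝕜 := ℝ) M (EuclideanSpace.single b (1 : ℝ)) a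
      = M a b := by
    rw [Matrix.ofLp_toEuclideanCLM]
    simp [Matrix.mulVec_single]
  rwa [h3] at h2

theorem abs_transpose_mul_mul_sub_le {n : ℕ} {P W M : Matrix (Fin n) (Fin n) ℝ} {r ε μ : ℝ}
    (hε : 0 ≤ ε) (hP : ∀ i j, |P i j| ≤ r) (hW : ∀ i j, |W i j| ≤ 1)
    (hPW : ∀ i j, |P i j - W i j| ≤ ε) (hM : ∀ i j, |M i j| ≤ μ) (a b : Fin n) :
    |(Pᵀ * M * P) a b - (Wᵀ * M * W) a b| ≤ n ^ 2 * (ε * (r + 1) * μ) := by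
  have hexp : ∀ X : Matrix (Fin n) (Fin n) ℝ,
      (Xᵀ * M * X) a b = ∑ j, ∑ i, X i a * M i j * X j b := by
    intro X
    simp only [Matrix.mul_apply, Matrix.transpose_apply, Finset.sum_mul]
  rw [hexp, hexp, ← Finset.sum_sub_distrib]
  simp only [← Finset.sum_sub_distrib]
  refine (Finset.abs_sum_le_sum_abs _ _).trans ?_
  calc _ ≤ ∑ _j : Fin n, ∑ _i : Fin n, ε * (r + 1) * μ := by
        refine Finset.sum_le_sum fun j _ => (Finset.abs_sum_le_sum_abs _ _).trans ?_
        refine Finset.sum_le_sum fun i _ => ?_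
        rw [show P i a * M i j * P j b - W i a * M i j * W j b =
          ((P i a - W i a) * P j b + W i a * (P j b - W j b)) * M i j by ring, abs_mul]
        have hr : 0 ≤ r := (abs_nonneg _).trans (hP i j)
        refine mul_le_mul ?_ (hM i j) (abs_nonneg _) (by positivity)
        refine (abs_add_le _ _).trans ?_
        rw [abs_mul, abs_mul]
        have h1 := mul_le_mul (hPW i a) (hP j b) (abs_nonneg _) hε
        have h2 := mul_le_mul (hW i a) (hPW j b) (abs_nonneg _) zero_le_one
        linarith
    _ = _ := by simp; ring

theorem abs_transpose_mul_mul_le {n : ℕ} {P M : Matrix (Fin n) (Fin n) ℝ} {r μ : ℝ}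
    (hP : ∀ i j, |P i j| ≤ r) (hM : ∀ i j, |M i j| ≤ μ) (a b : Fin n) :
    |(Pᵀ * M * P) a b| ≤ n ^ 2 * (r ^ 2 * μ) := by
  have hexp : (Pᵀ * M * P) a b = ∑ j, ∑ i, P i a * M i j * P j b := by
    simp only [Matrix.mul_apply, Matrix.transpose_apply, Finset.sum_mul]
  rw [hexp]
  refine (Finset.abs_sum_le_sum_abs _ _).trans ?_
  calc _ ≤ ∑ _j : Fin n, ∑ _i : Fin n, r ^ 2 * μ := by
        refine Finset.sum_le_sum fun j _ => (Finset.abs_sum_le_sum_abs _ _).trans ?_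
        refine Finset.sum_le_sum fun i _ => ?_
        have hr : 0 ≤ r := (abs_nonneg _).trans (hP i j)
        have hμ : 0 ≤ μ := (abs_nonneg _).trans (hM i j)
        rw [abs_mul, abs_mul]
        calc _ ≤ r * μ * r := by
              gcongr
              · exact hP i a
              · exact hM i j
              · exact hP j b
          _ = _ := by ring
    _ = _ := by simp; ring

theorem abs_le_of_mem_spectrum {n : ℕ} {T : Matrix (Fin n) (Fin n) ℝ} {B l : ℝ}
    (hT : ∀ a b, |T a b| ≤ B) (hl : l ∈ spectrum ℝ T) : |l| ≤ n * B := by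
  have hev : Module.End.HasEigenvalue (Matrix.toLin' T) l := by
    rw [Module.End.hasEigenvalue_iff_mem_spectrum, Matrix.spectrum_toLin']
    exact hl
  obtain ⟨k, hk⟩ := eigenvalue_mem_ball hev
  rw [Metric.mem_closedBall, Real.dist_eq] at hk
  simp only [Real.norm_eq_abs] at hk
  have h1 := Finset.add_sum_erase Finset.univ (fun j => |T k j|) (Finset.mem_univ k)
  have h2 : ∑ j, |T k j| ≤ n * B := by
    calc _ ≤ ∑ _j : Fin n, B := Finset.sum_le_sum fun j _ => hT k j
      _ = _ := by simp
  have h3 := abs_sub_abs_le_abs_sub l (T k k)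
  linarith

theorem off_eq_zero_of_spectrum_subsingleton {n : ℕ} {T : Matrix (Fin n) (Fin n) ℝ}
    (hT : T.IsSymm) (h : ∀ l ∈ spectrum ℝ T, ∀ m ∈ spectrum ℝ T, l = m) :
    frobNorm (off T) = 0 := by
  classical
  obtain ⟨U, Λ, hΛ, h1, h2, -⟩ := exists_spectral_decomposition hT
  have h0 : ∀ a b, a ≠ b → T a b = 0 := by
    intro a b hab
    have : T a b = Λ a * ∑ j, U a j * U b j := by
      rw [h2, Finset.mul_sum]
      refine Finset.sum_congr rfl fun j _ => ?_
      rw [h _ (hΛ j) _ (hΛ a)]; ring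
    rw [this, h1, if_neg hab, mul_zero]
  have hsq : frobNorm (off T) ^ 2 = 0 := by
    rw [sq_frobNorm_off, energy]
    refine Finset.sum_eq_zero fun a _ => Finset.sum_eq_zero fun b _ => ?_
    split_ifs with hab
    · rw [h0 a b hab.1]; norm_num
    · rfl
  exact pow_eq_zero_iff two_ne_zero |>.mp hsq

theorem frobNorm_off_le {n : ℕ} {T : Matrix (Fin n) (Fin n) ℝ} {κ : ℝ} (hκ : 0 ≤ κ)
    (h : ∀ a b, a ≠ b → |T a b| ≤ κ) : frobNorm (off T) ≤ n * κ := by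
  refine le_of_sq_le_sq ?_ (by positivity)
  rw [sq_frobNorm_off, energy]
  calc _ ≤ ∑ _a : Fin n, ∑ _b : Fin n, κ ^ 2 := by
        refine Finset.sum_le_sum fun a _ => Finset.sum_le_sum fun b _ => ?_
        split_ifs with hab
        · rw [← sq_abs]; exact pow_le_pow_left₀ (abs_nonneg _) (h a b hab.1) 2
        · positivity
    _ = _ := by simp; ring

/-- The matrix at the start of the Jacobi iteration is close to an ordered diagonal matrix, provided
that the precision is sufficient. -/
theorem exists_initial_bound (n : ℕ) (p : ℝ) :
    ∃ K υ₀ : ℝ, 0 ≤ K ∧ 0 < υ₀ ∧ ∀ (A Z Q : Matrix (Fin n) (Fin n) ℝ) (υ ω : ℝ),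
      0 < ω → ω ≤ υ → υ ≤ 1 / 2 → υ ≤ υ₀ → IsComputedEigenvectors p υ A Z → IsComputedMGS ω Z Q →
      ∃ D : Fin n → ℝ, (Monotone D ∨ Antitone D) ∧
        ∀ a b, |(Qᵀ * A * Q) a b - diagonal D a b| ≤ K * specNorm A * υ := by
  obtain ⟨K, υ₀, hK, hυ₀, h⟩ := exists_mgs_bound n (abs_nonneg p)
  refine ⟨n ^ 2 * (K * (2 ^ (n + 3) + 1)) + n ^ 2 * |p|, υ₀, by positivity, hυ₀, ?_⟩
  intro A Z Q υ ω hω hωυ hυ hυ0 hZ hQ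
  obtain ⟨D, E, δZ, hD, hW, hδ, hE, hAE⟩ := hZ
  have hυpos : 0 ≤ υ := hω.le.trans hωυ
  have hA0 := specNorm_nonneg A
  set W := Z + δZ with hWdef
  have hW1 : ∀ i j, |W i j| ≤ 1 := fun i j => by simpa using entry_norm_bound_of_unitary hW i j
  have hZW : ∀ i j, |Z i j - W i j| ≤ |p| * υ := by
    intro i j
    have e : Z i j - W i j = - δZ i j := by simp [hWdef]
    rw [e, abs_neg]
    refine (abs_apply_le_specNorm δZ i j).trans (hδ.trans ?_)
    exact mul_le_mul_of_nonneg_right (le_abs_self p) hυpos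
  have hQW := h ω υ W Z Q hω.le hωυ hυ0 hW hZW hQ
  have hQ1 := fun i j => hQ.abs_apply_le hω.le (hωυ.trans hυ) i j
  refine ⟨D, hD, fun a b => ?_⟩
  have hWW : Wᵀ * W = 1 := Matrix.mem_orthogonalGroup_iff' (Fin n) ℝ |>.mp hW
  have hWA : Wᵀ * A * W = diagonal D - Wᵀ * E * W := by
    have : Wᵀ * (A + E) * W = diagonal D := by
      rw [hAE]
      calc _ = (Wᵀ * W) * diagonal D * (Wᵀ * W) := by simp only [Matrix.mul_assoc]
        _ = _ := by rw [hWW, Matrix.one_mul, Matrix.mul_one]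
    rw [← this, Matrix.mul_add Wᵀ A E, Matrix.add_mul, add_sub_cancel_right]
  have e1 := abs_transpose_mul_mul_sub_le (by positivity) hQ1 hW1 hQW
    (abs_apply_le_specNorm A) a b
  have e2 := abs_transpose_mul_mul_le hW1 (abs_apply_le_specNorm E) a b
  have e3 : (Wᵀ * A * W) a b - diagonal D a b = - (Wᵀ * E * W) a b := by
    rw [hWA, Matrix.sub_apply]; ring
  have e4 : specNorm E ≤ |p| * specNorm A * υ := hE.trans (by
    have := le_abs_self p
    gcongr)
  have e5 : (n : ℝ) ^ 2 * (1 ^ 2 * specNorm E) ≤ n ^ 2 * (1 ^ 2 * (|p| * specNorm A * υ)) := by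
    gcongr
  have e6 := abs_sub_le ((Qᵀ * A * Q) a b) ((Wᵀ * A * W) a b) (diagonal D a b)
  rw [e3, abs_neg] at e6
  linarith

/-- The quadratic bound for a fixed dimension and error constant of the eigensolver. -/
theorem exists_precision_constant (n : ℕ) (p : ℝ) :
    ∃ γ : ℝ, 0 < γ ∧ ∀ (A Z Q : Matrix (Fin n) (Fin n) ℝ) (υ ω ν d : ℝ), A.IsSymm →
      0 < ω → ω ≤ υ → υ ≤ 1 / 2 → IsComputedEigenvectors p υ A Z → IsComputedMGS ω Z Q → 0 < d →
      (∀ l ∈ spectrum ℝ (Qᵀ * A * Q), ∀ m ∈ spectrum ℝ (Qᵀ * A * Q), l ≠ m → d ≤ |l - m|) →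
      γ * specNorm A * υ < d / (4 * Real.sqrt 2) →
      frobNorm (off (jacobiIterate ν (Qᵀ * A * Q) (n * (n - 1) / 2))) ≤
        Real.sqrt (34 / 9) / d * frobNorm (off (Qᵀ * A * Q)) ^ 2 := by
  obtain ⟨K, υ₀, hK, hυ₀, h⟩ := exists_initial_bound n p
  set B : ℝ := n ^ 2 * (2 ^ (n + 3)) ^ 2 with hB
  have hB0 : 0 ≤ B := by positivity
  refine ⟨1000 * (n + 1) ^ 4 * (K + 1) + n * B / υ₀, by positivity, ?_⟩
  intro A Z Q υ ω ν d hA hω hωυ hυ hZ hQ hd hgap hsmall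
  set T := Qᵀ * A * Q with hTdef
  have hT : T.IsSymm := by
    unfold Matrix.IsSymm
    rw [hTdef, Matrix.transpose_mul, Matrix.transpose_mul, Matrix.transpose_transpose, hA.eq,
      Matrix.mul_assoc]
  have hA0 := specNorm_nonneg A
  have hυpos : 0 < υ := hω.trans_le hωυ
  by_cases hspec : ∀ l ∈ spectrum ℝ T, ∀ m ∈ spectrum ℝ T, l = m
  · have h0 := off_eq_zero_of_spectrum_subsingleton hT hspec
    refine (frobNorm_off_jacobiIterate_le_self ν hT).trans ?_
    rw [h0]; positivity
  push Not at hspec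
  obtain ⟨l, hl, m, hm, hlm⟩ := hspec
  have hbound : ∀ a b, |T a b| ≤ B * specNorm A := fun a b => by
    have := abs_transpose_mul_mul_le
      (fun i j => hQ.abs_apply_le hω.le (hωυ.trans hυ) i j) (abs_apply_le_specNorm A) a b
    rw [hB]; linarith
  have hdA : d ≤ 2 * (n * (B * specNorm A)) := by
    have h1 := abs_le_of_mem_spectrum hbound hl
    have h2 := abs_le_of_mem_spectrum hbound hm
    have h3 := abs_sub l m
    have h4 := hgap l hl m hm hlm
    linarith
  have hApos : 0 < specNorm A := by
    rcases hA0.eq_or_lt with h0 | h0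
    · rw [← h0] at hdA; linarith
    · exact h0
  have hlt : (1000 * (n + 1) ^ 4 * (K + 1) + n * B / υ₀) * specNorm A * υ < d / 4 := by
    refine hsmall.trans_le ?_
    have : (1 : ℝ) ≤ Real.sqrt 2 := Real.one_le_sqrt.mpr (by norm_num)
    gcongr
    linarith
  have hsplit : (1000 * (n + 1) ^ 4 * (K + 1) + n * B / υ₀) * specNorm A * υ =
      1000 * (n + 1) ^ 4 * (K * specNorm A * υ) + 1000 * (n + 1) ^ 4 * (specNorm A * υ) +
        n * B / υ₀ * specNorm A * υ := by ring
  set κ := K * specNorm A * υ with hκ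
  have hκ0 : 0 ≤ κ := by positivity
  have p1 : 0 ≤ 1000 * (n + 1 : ℝ) ^ 4 * (specNorm A * υ) := by positivity
  have p2 : 0 ≤ n * B / υ₀ * specNorm A * υ := by positivity
  have p3 : 0 ≤ 1000 * (n + 1 : ℝ) ^ 4 * κ := by positivity
  have hκd : 1000 * (n + 1 : ℝ) ^ 4 * κ < d / 4 := by linarith
  have hυ1 : υ ≤ υ₀ := by
    have h1 : n * B / υ₀ * specNorm A * υ ≤ n * B * specNorm A := by linarith
    by_contra! hcon
    have h2 : n * B * specNorm A * υ ≤ n * B * specNorm A * υ₀ := by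
      have : n * B / υ₀ * specNorm A * υ = n * B * specNorm A * υ / υ₀ := by ring
      rwa [this, div_le_iff₀ hυ₀] at h1
    have h3 : 0 < n * B * specNorm A := by linarith
    nlinarith
  obtain ⟨D, hD, hTD⟩ := h A Z Q υ ω hω hωυ hυ hυ1 hZ hQ
  have hoff : frobNorm (off T) ≤ n * κ := frobNorm_off_le hκ0 fun a b hab => by
    have := hTD a b
    rwa [diagonal_apply_ne _ hab, sub_zero] at this
  have hn0 : (0 : ℝ) ≤ n := n.cast_nonneg
  have hn1 : (1 : ℝ) ≤ (n + 1 : ℝ) ^ 3 := one_le_pow₀ (by linarith)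
  have e1 : (n + 1) * κ ≤ (n + 1 : ℝ) ^ 4 * κ := by
    have : (n + 1 : ℝ) ^ 4 = (n + 1 : ℝ) ^ 3 * (n + 1) := by ring
    rw [this, mul_assoc]
    exact le_mul_of_one_le_left (by positivity) hn1
  refine frobNorm_off_jacobiIterate_le ν hT hd hgap hD (κ := κ) (fun a => ?_) ?_ ?_
  · have := hTD a a
    rwa [diagonal_apply_eq] at this
  · linarith
  · have : 1000 * (n + 1 : ℝ) ^ 3 * frobNorm (off T) ≤ 1000 * (n + 1 : ℝ) ^ 3 * (n * κ) := by gcongr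
    have e2 : 1000 * (n + 1 : ℝ) ^ 3 * (n * κ) ≤ 1000 * (n + 1 : ℝ) ^ 4 * κ := by
      have : 1000 * (n + 1 : ℝ) ^ 4 * κ =
        1000 * (n + 1 : ℝ) ^ 3 * (n * κ) + 1000 * (n + 1 : ℝ) ^ 3 * κ := by ring
      rw [this]
      have : 0 ≤ 1000 * (n + 1 : ℝ) ^ 3 * κ := by positivity
      linarith
    linarith

end MixedJacobi

end

theorem mainTheorem2 (p : ℕ → ℝ) :
    ∃ γ₁ : ℕ → ℝ, (∀ n : ℕ, 0 < γ₁ n) ∧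
      ∀ (n : ℕ) (A Z Q : Matrix (Fin n) (Fin n) ℝ) (υ ω ν d : ℝ),
        A.IsSymm →
        0 < ω → ω ≤ υ → υ ≤ 1 / 2 → 0 < ν →
        MixedJacobi.IsComputedEigenvectors (p n) υ A Z →
        MixedJacobi.IsComputedMGS ω Z Q →
        0 < d →
        (∀ l ∈ spectrum ℝ (Q.transpose * A * Q), ∀ m ∈ spectrum ℝ (Q.transpose * A * Q),
          l ≠ m → d ≤ |l - m|) →
        γ₁ n * MixedJacobi.specNorm A * υ < d / (4 * Real.sqrt 2) →
        MixedJacobi.frobNorm (MixedJacobi.off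
            (MixedJacobi.jacobiIterate ν (Q.transpose * A * Q) (n * (n - 1) / 2))) ≤
          Real.sqrt (34 / 9) / d *
            MixedJacobi.frobNorm (MixedJacobi.off (Q.transpose * A * Q)) ^ 2 := by
  choose γ hγ h using fun n => MixedJacobi.exists_precision_constant n (p n)
  exact ⟨γ, hγ, fun n A Z Q υ ω ν d hA hω hωυ hυ _ hZ hQ hd hgap hsmall =>
    h n A Z Q υ ω ν d hA hω hωυ hυ hZ hQ hd hgap hsmall⟩
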